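/- Let $k$ be a field. A sheaf on a finite poset $X$ is a functor from $X$ to finite-dimensional $k$-vector spaces, i.e. finite-dimensional spaces $F(x)$ and functorial linear maps $F(x\le y):F(x)\to F(y)$; $X$ carries the Alexandrov topology, whose open sets are the upward closed sets, and $D^b(X)$ denotes the bounded derived category of sheaves on $X$. For a locally closed subset $Z\subseteq X$ (an intersection of an open and a closed set) with inclusion $i_Z:Z\hookrightarrow X$, let $i_Z^*$ be restriction to $Z$, let $i_{Z!}$ be extension by zero, and let $i_Z^!F(z)=\{v\in F(z): F(z\le y)(v)=0 \text{ for all } y\ge z,\ y\in X\setminus Z\}$ for $z\in Z$. Write $Ri_Z^*$, $Ri_{Z!}$, $Ri_Z^!$ for the right derived functors, $\mathbb{H}^d(I^\bullet)=H^d(Rp_*I^\bullet)$ for hypercohomology, where $p_*F=\varprojlim_{x\in X}F(x)$, and $\chi I^\bullet=\sum_{j\in\mathbb{Z}}(-1)^j\dim\mathbb{H}^j(I^\bullet)$. Theorem (Discrete Microlocal Morse Inequality). Let $f:\Lambda\to\Pi$ be an order preserving map of finite posets and let $I^\bullet\in D^b(\Lambda)$. Let $\kappa^!\subseteq\Pi$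 be the set of $\pi\in\Pi$ such that $\mathbb{H}^d\big(Ri^!_{f^{-1}(\pi)}I^\bullet\big)\ne0$ for some $d\in\mathbb{Z}$, and let $\kappa^*\subseteq\Pi$ be the set of $\pi\in\Pi$ such that $\mathbb{H}^d\big(Ri_{f^{-1}(\pi)!}Ri^*_{f^{-1}(\pi)}I^\bullet\big)\ne0$ for some $d\in\mathbb{Z}$. For each of $I^\bullet$, $Ri^!_{f^{-1}(\pi)}I^\bullet$ and $Ri_{f^{-1}(\pi)!}Ri^*_{f^{-1}(\pi)}I^\bullet$ ($\pi\in\Pi$), only finitely many hypercohomology spaces are nonzero, so that all sums below are finite. For each $\ell\in\mathbb{Z}$, \begin{align*} (-1)^\ell\sum_{j\le\ell}(-1)^j\dim\mathbb{H}^j(I^\bullet)&\le(-1)^\ell\sum_{\pi\in\kappa^!}\sum_{j\le\ell}(-1)^j\dim\mathbb{H}^j\big(Ri^!_{f^{-1}(\pi)}I^\bullet\big),\\ (-1)^\ell\sum_{j\le\ell}(-1)^j\dim\mathbb{H}^j(I^\bullet)&\le(-1)^\ell\sum_{\pi\in\kappa^*}\sum_{j\le\ell}(-1)^j\dim\mathbb{H}^j\big(Ri_{f^{-1}(\pi)!}Ri^*_{f^{-1}(\pi)}I^\bullet\big).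 \end{align*} Moreover, $$\chi I^\bullet=\sum_{\pi\in\kappa^!}\chi Ri^!_{f^{-1}(\pi)}I^\bullet=\sum_{\pi\in\kappa^*}\chi Ri_{f^{-1}(\pi)!}Ri^*_{f^{-1}(\pi)}I^\bullet .$$ -/

import Mathlib

open CategoryTheory CategoryTheory.Limits

universe u v w

noncomputable section

namespace MorsePoset

/-! ### Sheaves on a finite poset -/

section Sheaves

variable (k : Type u) [Field k] (X : Type v) [PartialOrder X]

/-- A sheaf on the poset `X`: a finite-dimensional `k`-vector space `F(x)` for every `x`, and
functorial linear maps `F(x ≤ y) : F(x) → F(y)`. Morphisms are the natural transformations. -/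
abbrev PosetSheaf := X ⥤ FGModuleCat.{u} k

variable {X}

/-- `Z` is locally closed in the Alexandrov topology (whose open sets are the upward closed
sets): `Z` is the intersection of an open and a closed set. -/
def LocallyClosed (Z : Set X) : Prop := @IsLocallyClosed X (Topology.upperSet X) Z

theorem LocallyClosed.mem_of_le {Z : Set X} (hZ : LocallyClosed Z) {x y z : X}
    (hx : x ∈ Z) (hz : z ∈ Z) (hxy : x ≤ y) (hyz : y ≤ z) : y ∈ Z := by
  obtain ⟨U, C, hU, hC, rfl⟩ := hZ
  have hU' : IsUpperSet U := hU
  have hC' : IsLowerSet C := by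
    rw [← isUpperSet_compl]
    exact hC.isOpen_compl
  exact ⟨hU' hxy hx.1, hC' hyz hz.2⟩

theorem locallyClosed_fiber {Y : Type w} [PartialOrder Y] (f : X →o Y) (y : Y) :
    LocallyClosed (f ⁻¹' {y}) := by
  refine ⟨f ⁻¹' Set.Ici y, f ⁻¹' Set.Iic y, ?_, ?_, ?_⟩
  · exact (isUpperSet_Ici y).preimage f.monotone
  · refine @IsClosed.mk X (Topology.upperSet X) _ ?_
    change IsUpperSet (f ⁻¹' Set.Iic y)ᶜ
    rw [isUpperSet_compl]
    exact (isLowerSet_Iic y).preimage f.monotone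
  · ext x
    simp [le_antisymm_iff, and_comm]

/-- The pullback `i_Z^* F = F|_Z` along the inclusion of `Z`. -/
def sheafPullback (Z : Set X) : PosetSheaf k X ⥤ PosetSheaf k Z :=
  (Functor.whiskeringLeft _ _ _).obj (Subtype.mono_coe (· ∈ Z)).functor

variable {k}

/-- The value at `x` of the proper pushforward: functions on the proofs of `x ∈ Z` with values in
`F(x)`, that is `F(x)` if `x ∈ Z` and `0` otherwise. -/
abbrev ExtVal {Z : Set X} (F : PosetSheaf k Z) (x : X) : Type u :=
  (h : PLift (x ∈ Z)) → F.obj ⟨x, h.down⟩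

open Classical in
/-- The restriction maps of the proper pushforward: `F(x ≤ y)` if `x, y ∈ Z`, zero otherwise. -/
def extMap {Z : Set X} (F : PosetSheaf k Z) {x y : X} (hxy : x ≤ y) :
    ExtVal F x →ₗ[k] ExtVal F y :=
  LinearMap.pi fun hy =>
    if hx : x ∈ Z then
      (F.map (homOfLE (show (⟨x, hx⟩ : Z) ≤ ⟨y, hy.down⟩ from hxy))).hom.hom.comp
        (LinearMap.proj ⟨hx⟩)
    else 0

theorem extMap_of_mem {Z : Set X} (F : PosetSheaf k Z) {x y : X} (hxy : x ≤ y)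
    (v : ExtVal F x) (hx : x ∈ Z) (hy : PLift (y ∈ Z)) :
    extMap F hxy v hy =
      (F.map (homOfLE (show (⟨x, hx⟩ : Z) ≤ ⟨y, hy.down⟩ from hxy))).hom.hom (v ⟨hx⟩) := by
  simp [extMap, hx]

theorem extMap_of_notMem {Z : Set X} (F : PosetSheaf k Z) {x y : X} (hxy : x ≤ y)
    (v : ExtVal F x) (hx : x ∉ Z) (hy : PLift (y ∈ Z)) : extMap F hxy v hy = 0 := by
  simp [extMap, hx]

variable (k) in
/-- The proper pushforward `i_{Z!}` along the inclusion of a locally closed set: extension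
by zero. -/
def properPushforward {Z : Set X} (hZ : LocallyClosed Z) : PosetSheaf k Z ⥤ PosetSheaf k X where
  obj F :=
    { obj := fun x => FGModuleCat.of k (ExtVal F x)
      map := fun f => FGModuleCat.ofHom (extMap F (leOfHom f))
      map_id := by
        intro x
        refine FGModuleCat.hom_ext (LinearMap.ext fun v => funext fun h => ?_)
        refine (extMap_of_mem F (le_refl x) v h.down h).trans ?_
        exact congrArg (fun g => g.hom.hom (v h)) (F.map_id ⟨x, h.down⟩)
      map_comp := by
        intro x y z f g
        refine FGModuleCat.hom_ext (LinearMap.ext fun v => funext fun h => ?_)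
        change extMap F (leOfHom (f ≫ g)) v h = extMap F (leOfHom g) (extMap F (leOfHom f) v) h
        by_cases hx : x ∈ Z
        · have hy : y ∈ Z := hZ.mem_of_le hx h.down (leOfHom f) (leOfHom g)
          rw [extMap_of_mem F _ v hx h, extMap_of_mem F _ _ hy h, extMap_of_mem F _ v hx ⟨hy⟩]
          exact congrArg (fun g => g.hom.hom (v ⟨hx⟩))
            (F.map_comp (homOfLE (show (⟨x, hx⟩ : Z) ≤ ⟨y, hy⟩ from leOfHom f))
              (homOfLE (show (⟨y, hy⟩ : Z) ≤ ⟨z, h.down⟩ from leOfHom g)))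
        · rw [extMap_of_notMem F _ v hx h]
          by_cases hy : y ∈ Z
          · rw [extMap_of_mem F _ _ hy h, extMap_of_notMem F _ v hx ⟨hy⟩, map_zero]
          · rw [extMap_of_notMem F _ _ hy h] }
  map {F G} η :=
    { app := fun x => FGModuleCat.ofHom
        (LinearMap.pi fun h => (η.app ⟨x, h.down⟩).hom.hom.comp (LinearMap.proj h))
      naturality := by
        intro x y f
        refine FGModuleCat.hom_ext (LinearMap.ext fun v => funext fun h => ?_)
        change (η.app ⟨y, h.down⟩).hom.hom (extMap F (leOfHom f) v h) =
          extMap G (leOfHom f) (fun h' => (η.app ⟨x, h'.down⟩).hom.hom (v h')) h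
        by_cases hx : x ∈ Z
        · rw [extMap_of_mem F _ v hx h, extMap_of_mem G _ _ hx h]
          exact congrArg (fun g => g.hom.hom (v ⟨hx⟩))
            (η.naturality (homOfLE (show (⟨x, hx⟩ : Z) ≤ ⟨y, h.down⟩ from leOfHom f)))
        · rw [extMap_of_notMem F _ v hx h, extMap_of_notMem G _ _ hx h, map_zero] }
  map_id _ := rfl
  map_comp _ _ := rfl

/-- The vectors of `F(z)` that restrict to zero at every `y ≥ z` outside `Z`. -/
def supportedAt (Z : Set X) (F : PosetSheaf k X) (z : X) : Submodule k (F.obj z) where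
  carrier := {v | ∀ (y : X) (h : z ≤ y), y ∉ Z → (F.map (homOfLE h)).hom.hom v = 0}
  add_mem' := by
    intro a b ha hb y h hy
    rw [map_add, ha y h hy, hb y h hy, add_zero]
  zero_mem' := by
    intro y h hy
    rw [map_zero]
  smul_mem' := by
    intro c a ha y h hy
    rw [map_smul, ha y h hy, smul_zero]

variable (k) in
/-- The proper pullback `i_Z^!` along the inclusion of `Z`: its value at `z ∈ Z` consists of the
vectors of `F(z)` that restrict to zero at every `y ≥ z` outside `Z`. -/
def properPullback (Z : Set X) : PosetSheaf k X ⥤ PosetSheaf k Z where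
  obj F :=
    { obj := fun z => FGModuleCat.of k (supportedAt Z F z.1)
      map := fun {z z'} f => FGModuleCat.ofHom
        ((F.map (homOfLE (leOfHom f : z.1 ≤ z'.1))).hom.hom.restrict (by
          intro a ha y h hy
          refine Eq.trans ?_ (ha y ((leOfHom f : z.1 ≤ z'.1).trans h) hy)
          exact (congrArg (fun g => g.hom.hom a)
            (F.map_comp (homOfLE (leOfHom f : z.1 ≤ z'.1)) (homOfLE h))).symm))
      map_id := by
        intro z
        refine FGModuleCat.hom_ext (LinearMap.ext fun v => Subtype.ext ?_)
        exact congrArg (fun g => g.hom.hom v.1) (F.map_id z.1)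
      map_comp := by
        intro z z' z'' f g
        refine FGModuleCat.hom_ext (LinearMap.ext fun v => Subtype.ext ?_)
        exact congrArg (fun g => g.hom.hom v.1)
          (F.map_comp (homOfLE (leOfHom f : z.1 ≤ z'.1)) (homOfLE (leOfHom g : z'.1 ≤ z''.1))) }
  map {F G} η :=
    { app := fun z => FGModuleCat.ofHom ((η.app z.1).hom.hom.restrict (by
        intro a ha y h hy
        refine (congrArg (fun g => g.hom.hom a) (η.naturality (homOfLE h))).symm.trans ?_
        change (η.app y).hom.hom ((F.map (homOfLE h)).hom.hom a) = 0
        rw [ha y h hy, map_zero]))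
      naturality := by
        intro z z' f
        refine FGModuleCat.hom_ext (LinearMap.ext fun v => Subtype.ext ?_)
        exact congrArg (fun g => g.hom.hom v.1)
          (η.naturality (homOfLE (leOfHom f : z.1 ≤ z'.1))) }
  map_id _ := rfl
  map_comp _ _ := rfl

instance (Z : Set X) : (sheafPullback k Z).Additive where
  map_add := rfl

instance {Z : Set X} (hZ : LocallyClosed Z) : (properPushforward k hZ).Additive where
  map_add := rfl

instance (Z : Set X) : (properPullback k Z).Additive where
  map_add := rfl

variable (k X)

instance [Finite X] : HasLimitsOfShape X (FGModuleCat.{u} k) := by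
  classical
  have := Fintype.ofFinite X
  have : FinCategory X :=
    { fintypeObj := inferInstance
      fintypeHom := fun a b =>
        if h : a ≤ b then
          ⟨{homOfLE h}, fun f => by rw [Finset.mem_singleton]; exact Subsingleton.elim _ _⟩
        else ⟨∅, fun f => absurd (leOfHom f) h⟩ }
  exact hasLimitsOfShape_of_hasFiniteLimits _ X

/-- The pushforward `p_*` to the one-point poset, whose sheaves are the finite-dimensional vector
spaces: `p_* F = lim_{x ∈ X} F(x)`. -/
def globalSections [Finite X] : PosetSheaf k X ⥤ FGModuleCat.{u} k := lim

instance [Finite X] : (globalSections k X).Additive where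
  map_add {F G η θ} := by
    change lim.map (η + θ) = lim.map η + lim.map θ
    refine limit.hom_ext fun x => ?_
    simp

instance fgModuleCat_injective (V : FGModuleCat.{u} k) : Injective V where
  factors {A B} g f hf := by
    have : Mono ((forget₂ (FGModuleCat.{u} k) (ModuleCat.{u} k)).map f) := inferInstance
    have hinj : Function.Injective f.hom.hom := (ModuleCat.mono_iff_injective _).1 this
    obtain ⟨r, hr⟩ := f.hom.hom.exists_leftInverse_of_injective (LinearMap.ker_eq_bot.2 hinj)
    refine ⟨FGModuleCat.ofHom (g.hom.hom.comp r), ?_⟩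
    ext x
    exact congrArg g.hom.hom (LinearMap.congr_fun hr x)

instance [Finite X] : EnoughInjectives (PosetSheaf k X) where
  presentation F := by
    have : Finite X := inferInstance
    have (a b : X) : HasProductsOfShape (a ⟶ b) (FGModuleCat.{u} k) := inferInstance
    let J : X → PosetSheaf k X := fun c =>
      (evaluationRightAdjoint (FGModuleCat.{u} k) c).obj (F.obj c)
    have hJ (c : X) : Injective (J c) :=
      Injective.injective_of_adjoint (evaluationAdjunctionLeft (FGModuleCat.{u} k) c) (F.obj c)
    let e : F ⟶ ∏ᶜ J := Pi.lift fun c => (evaluationAdjunctionLeft (FGModuleCat.{u} k) c).unit.app F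
    have he : Mono e := by
      have (c : X) : Mono (e.app c) := by
        have h₁ : e ≫ Pi.π J c =
            (evaluationAdjunctionLeft (FGModuleCat.{u} k) c).unit.app F := Pi.lift_π _ _
        have h₂ : e.app c ≫ (Pi.π J c).app c ≫
            (evaluationAdjunctionLeft (FGModuleCat.{u} k) c).counit.app (F.obj c) =
            𝟙 (F.obj c) := by
          rw [← Category.assoc, ← NatTrans.comp_app, h₁]
          exact (evaluationAdjunctionLeft (FGModuleCat.{u} k) c).left_triangle_components F
        have : Mono (𝟙 (F.obj c)) := inferInstance
        exact mono_of_mono_fac h₂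
      exact NatTrans.mono_of_mono_app e
    exact ⟨⟨∏ᶜ J, inferInstance, e, he⟩⟩

end Sheaves

/-! ### Derived categories and derived functors

The derived functors are Mathlib's: on a bounded below complex of injective sheaves `I`, the
complex `RF(I)` is represented by `F(I)`. -/

section Derived

variable (k : Type u) [Field k] (X : Type v) [PartialOrder X]

instance : HasDerivedCategory (PosetSheaf k X) := HasDerivedCategory.standard _

instance : HasDerivedCategory (FGModuleCat.{u} k) := HasDerivedCategory.standard _

/-- The bounded below derived category `D^+(X)` of sheaves on `X`. -/
abbrev DPlus := DerivedCategory.Plus (PosetSheaf k X)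

/-- The bounded derived category `D^b(X)` of sheaves on `X`. -/
abbrev Db := (DerivedCategory.TStructure.t (C := PosetSheaf k X)).bounded.FullSubcategory

variable {k X}

/-- An object of `D^b(X)`, seen in `D^+(X)`. -/
def Db.toPlus (I : Db k X) : DPlus k X := ⟨I.obj, I.property.1⟩

variable [Finite X]

/-- The right derived functor `R i_Z^*` of the pullback. -/
def RPullback (Z : Set X) : DPlus k X ⥤ DPlus k Z :=
  (sheafPullback k Z).rightDerivedFunctorPlus

/-- The right derived functor `R i_Z^!` of the proper pullback, for `Z` locally closed. -/
def RProperPullback {Z : Set X} (_hZ : LocallyClosed Z) : DPlus k X ⥤ DPlus k Z :=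
  (properPullback k Z).rightDerivedFunctorPlus

/-- The right derived functor `R i_{Z!}` of the proper pushforward, for `Z` locally closed. -/
def RProperPushforward {Z : Set X} (hZ : LocallyClosed Z) : DPlus k Z ⥤ DPlus k X :=
  (properPushforward k hZ).rightDerivedFunctorPlus

/-- Hypercohomology `ℍ^d(I) = H^d(R p_* I)`, where `p` is the map to the one-point poset. -/
def hypercohomology (d : ℤ) (I : DPlus k X) : FGModuleCat.{u} k :=
  (DerivedCategory.Plus.homologyFunctor (FGModuleCat.{u} k) d).obj
    ((globalSections k X).rightDerivedFunctorPlus.obj I)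

/-- `dim ℍ^d(I)`. -/
def hdim (d : ℤ) (I : DPlus k X) : ℕ := Module.finrank k (hypercohomology d I)

/-- `∑_{j ≤ ℓ} (-1)^j dim ℍ^j(I)`. -/
def truncatedEuler (ℓ : ℤ) (I : DPlus k X) : ℤ :=
  ∑ᶠ (j : ℤ) (_ : j ≤ ℓ), (j.negOnePow : ℤ) * (hdim j I : ℤ)

/-- The Euler characteristic `χ(I) = ∑_j (-1)^j dim ℍ^j(I)`. -/
def eulerChar (I : DPlus k X) : ℤ :=
  ∑ᶠ j : ℤ, (j.negOnePow : ℤ) * (hdim j I : ℤ)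

/-- Only finitely many hypercohomology spaces of `I` are nonzero. -/
def FiniteHypercohomology (I : DPlus k X) : Prop :=
  {j : ℤ | ¬ IsZero (hypercohomology j I)}.Finite

/-- The discrete `!`-microsupport: the locally closed `Z` such that `ℍ^d(R i_Z^! I) ≠ 0` for
some `d`. -/
def shriekMicrosupport (I : Db k X) : Set (Set X) :=
  {Z | ∃ hZ : LocallyClosed Z, ∃ d : ℤ,
    ¬ IsZero (hypercohomology d ((RProperPullback hZ).obj I.toPlus))}

/-- The discrete `*`-microsupport: the locally closed `Z` such that
`ℍ^d(R i_{Z!} R i_Z^* I) ≠ 0` for some `d`. -/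
def starMicrosupport (I : Db k X) : Set (Set X) :=
  {Z | ∃ hZ : LocallyClosed Z, ∃ d : ℤ,
    ¬ IsZero (hypercohomology d ((RProperPushforward hZ).obj ((RPullback Z).obj I.toPlus)))}

variable {Y : Type w} [PartialOrder Y]

/-- The `(I, f, !)`-critical elements. -/
def shriekCritical (I : Db k X) (f : X →o Y) : Set Y :=
  {y | f ⁻¹' {y} ∈ shriekMicrosupport I}

/-- The `(I, f, *)`-critical elements. -/
def starCritical (I : Db k X) (f : X →o Y) : Set Y :=
  {y | f ⁻¹' {y} ∈ starMicrosupport I}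

/-- `R i_{f⁻¹(y)}^! I`. -/
def shriekFiber (I : Db k X) (f : X →o Y) (y : Y) : DPlus k (f ⁻¹' {y} : Set X) :=
  (RProperPullback (locallyClosed_fiber f y)).obj I.toPlus

/-- `R i_{f⁻¹(y)!} R i_{f⁻¹(y)}^* I`. -/
def starFiber (I : Db k X) (f : X →o Y) (y : Y) : DPlus k X :=
  (RProperPushforward (locallyClosed_fiber f y)).obj ((RPullback (f ⁻¹' {y})).obj I.toPlus)

end Derived

end MorsePoset

end

/-!
The fibers of `f` are the steps of a filtration of `Λ` by the open sets `f⁻¹(U)`, for `U` running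
through upper sets of `P` to which one adds a maximal remaining element `p` at a time: an open set
`V` is the disjoint union of an open set `U` and of the locally closed set `Z = f⁻¹(p)`.

For every sheaf `F` the extensions by zero of the restrictions of `F` form a short exact sequence
`0 → F_U → F_V → F_Z → 0` (`shortExact_compare`). The functor `F ↦ Γ(Z, i_Z^! F)` is right adjoint
to the functor that sends a vector space `T` to `i_{Z!}` of the constant sheaf `T`, so the same
sequence for constant sheaves gives, for injective `F`, a short exact sequence
`0 → Γ(Z, i_Z^! F) → Γ(V, F) → Γ(U, F) → 0` (`shortExact_sections`).

Represent the given object by a complex `J` of injectives. Then `R i_{Z!} R i_Z^*` is computed by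
applying extension by zero of the restriction to `J` term by term since both functors are exact, and
`R i_Z^!` followed by hypercohomology is computed by `Γ(Z, i_Z^! J)` since `i_Z^!` preserves
injectives. Hypercohomology sends distinguished triangles to distinguished triangles
(`exists_distTriang_rightDerived`). In both cases each step of the filtration therefore gives a
long exact sequence, and the dimensions in a long exact sequence satisfy
`dim A^j + dim C^j = dim B^j + r j + r (j - 1)`, where `r j` is the rank of the connecting map from
`C^j` to `A^(j+1)` (`morseRel_of_distTriang`). These relations (`MorseRel`) add up along the
filtration, and the alternating sum truncated at `ℓ` of `r j + r (j - 1)` is `(-1)^ℓ r ℓ`; this is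
the Morse inequality, and the equality of Euler characteristics follows in the same way.

Finiteness comes from a bound on the injective dimension of sheaves on a finite poset
(`hasInjectiveDimensionLT_of_support`): it allows one to choose `J` bounded
(`exists_bounded_injective`).
-/

noncomputable section

namespace MorsePoset

/-! ### Right derived functors on the bounded below derived category -/

section RightDerived

open Pretriangulated

variable {C D : Type*} [Category* C] [Category* D] [Abelian C] [Abelian D]
  [HasDerivedCategory C] [HasDerivedCategory D]

/-- The cohomology of an object of `D^+` represented by a complex is that of the complex. -/
def homologyQIso (K : CochainComplex.Plus D) (n : ℤ) :
    (DerivedCategory.Plus.homologyFunctor D n).obj (DerivedCategory.Plus.Q.obj K) ≅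
      K.obj.homology n :=
  (DerivedCategory.homologyFunctor D n).mapIso
      ((DerivedCategory.quotientCompQhIso D).app K.obj) ≪≫
    (DerivedCategory.homologyFunctorFactors D n).app K.obj

theorem nonempty_iso_Q_of_quasiIso {K L : CochainComplex.Plus C} (i : K ⟶ L)
    [QuasiIso i.hom] :
    Nonempty (DerivedCategory.Plus.Q.obj K ≅ DerivedCategory.Plus.Q.obj L) :=
  let e : DerivedCategory.Q.obj K.obj ≅ DerivedCategory.Q.obj L.obj :=
    asIso (DerivedCategory.Q.map i.hom)
  ⟨DerivedCategory.Plus.ι.preimageIso e⟩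

variable (F : C ⥤ D) [F.Additive] [EnoughInjectives C]

/-- A right derived functor is computed by applying the functor to a complex of injectives. -/
def rightDerivedQIso (K : CochainComplex.Plus C) (hK : ∀ i, Injective (K.obj.X i)) :
    F.rightDerivedFunctorPlus.obj (DerivedCategory.Plus.Q.obj K) ≅
      DerivedCategory.Plus.Q.obj (F.mapCochainComplexPlus.obj K) :=
  haveI : IsIso (F.rightDerivedFunctorPlusUnit.app
      ((HomotopyCategory.Plus.quotient C).obj K)) := inferInstance
  (asIso (F.rightDerivedFunctorPlusUnit.app ((HomotopyCategory.Plus.quotient C).obj K))).symm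

/-- The derived functor of an exact functor is computed on any complex. -/
theorem nonempty_rightDerivedQIso_of_exact [F.PreservesHomology]
    (K : CochainComplex.Plus C) :
    Nonempty (F.rightDerivedFunctorPlus.obj (DerivedCategory.Plus.Q.obj K) ≅
      DerivedCategory.Plus.Q.obj (F.mapCochainComplexPlus.obj K)) := by
  obtain ⟨n, _⟩ := K.property
  obtain ⟨L, _, i, hi⟩ := CochainComplex.Plus.exists_quasiIso_injective K n
  have : QuasiIso i.hom := hi
  obtain ⟨e⟩ := nonempty_iso_Q_of_quasiIso i
  have : QuasiIso (F.mapCochainComplexPlus.map i).hom :=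
    inferInstanceAs (QuasiIso ((F.mapHomologicalComplex (.up ℤ)).map i.hom))
  obtain ⟨e'⟩ := nonempty_iso_Q_of_quasiIso (F.mapCochainComplexPlus.map i)
  exact ⟨F.rightDerivedFunctorPlus.mapIso e ≪≫
    rightDerivedQIso F _ (fun j => (L.obj.X j).property) ≪≫ e'.symm⟩

/-- Every distinguished triangle of `D^+` comes from one of complexes of injectives, to which
the functor can be applied term by term. -/
theorem exists_distTriang_rightDerived (T : Triangle (DerivedCategory.Plus C))
    (hT : T ∈ distTriang _) :
    ∃ T' ∈ distTriang (DerivedCategory.Plus D),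
      Nonempty (T'.obj₁ ≅ F.rightDerivedFunctorPlus.obj T.obj₁) ∧
      Nonempty (T'.obj₂ ≅ F.rightDerivedFunctorPlus.obj T.obj₂) ∧
      Nonempty (T'.obj₃ ≅ F.rightDerivedFunctorPlus.obj T.obj₃) := by
  let ι := (InjectiveObject.ι C).mapHomotopyCategoryPlus
  let G := ι ⋙ DerivedCategory.Plus.Qh
  have : ι.IsTriangulated :=
    inferInstanceAs (InjectiveObject.ι C).mapHomotopyCategoryPlus.IsTriangulated
  have : G.EssSurj := inferInstance
  let A := G.objPreimage T.obj₁
  let B := G.objPreimage T.obj₂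
  let eA : G.obj A ≅ T.obj₁ := G.objObjPreimageIso _
  let eB : G.obj B ≅ T.obj₂ := G.objObjPreimageIso _
  have hB : CochainComplex.IsKInjective (ι.obj B).1.as := by
    obtain ⟨n, hn⟩ : CochainComplex.plus C (ι.obj B).1.as :=
      (HomotopyCategory.plus_quotient_obj_iff _).1 (ι.obj B).property
    have (i : ℤ) : Injective ((ι.obj B).1.as.X i) :=
      inferInstanceAs (Injective ((InjectiveObject.ι C).obj (B.obj.as.X i)))
    exact CochainComplex.isKInjective_of_injective (ι.obj B).1.as n
  -- maps to a K-injective complex in the derived category come from the homotopy category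
  obtain ⟨φ', hφ'⟩ := (DerivedCategory.Plus.Qh_map_bijective_of_isKInjective (ι.obj A) (ι.obj B)
    hB).2 (eA.hom ≫ T.mor₁ ≫ eB.inv)
  obtain ⟨φ, rfl⟩ := ι.map_surjective φ'
  -- the cone is taken in the homotopy category of injectives, so its terms are injective
  obtain ⟨Z, g, h, H⟩ := distinguished_cocone_triangle φ
  have H₁ := ι.map_distinguished _ H
  have H₂ := DerivedCategory.Plus.Qh.map_distinguished _ H₁
  have H₃ := DerivedCategory.Plus.Qh.map_distinguished _
    (F.mapHomotopyCategoryPlus.map_distinguished _ H₁)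
  let e := isoTriangleOfIso₁₂ _ _ H₂ hT eA eB (by
    change DerivedCategory.Plus.Qh.map (ι.map φ) ≫ eB.hom = eA.hom ≫ T.mor₁
    rw [hφ']; simp)
  have u (W : HomotopyCategory.Plus (InjectiveObject C)) :
      DerivedCategory.Plus.Qh.obj (F.mapHomotopyCategoryPlus.obj (ι.obj W)) ≅
        F.rightDerivedFunctorPlus.obj (DerivedCategory.Plus.Qh.obj (ι.obj W)) :=
    asIso (F.rightDerivedFunctorPlusUnit.app
      ((InjectiveObject.ι C).mapHomotopyCategoryPlus.obj W))
  exact ⟨_, H₃, ⟨u A ≪≫ F.rightDerivedFunctorPlus.mapIso eA⟩,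
    ⟨u B ≪≫ F.rightDerivedFunctorPlus.mapIso eB⟩,
    ⟨u Z ≪≫ F.rightDerivedFunctorPlus.mapIso (Triangle.π₃.mapIso e)⟩⟩

end RightDerived

/-! ### Bounded injective representatives -/

section Bounded

variable {C : Type*} [Category* C] [Abelian C]

/-- The sequence `0 → Z^i → K^i → Z^(i+1) → 0` of a complex that is exact in degree `i + 1`. -/
theorem shortExact_cycles (K : CochainComplex C ℤ) (i : ℤ) (hK : K.ExactAt (i + 1)) :
    (ShortComplex.mk (K.iCycles i) (K.toCycles i (i + 1)) (by
      rw [← cancel_mono (K.iCycles (i + 1))]; simp)).ShortExact := by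
  have hker : IsLimit (KernelFork.ofι (K.iCycles i) (K.iCycles_d i (i + 1))) :=
    K.cyclesIsKernel i (i + 1) (by simp)
  refine { exact := ?_, mono_f := inferInstanceAs (Mono (K.iCycles i)), epi_g := ?_ }
  · refine ShortComplex.exact_of_f_is_kernel _ (KernelFork.IsLimit.ofι _ _
      (fun k hk => hker.lift (KernelFork.ofι k (by
        rw [← K.toCycles_i i (i + 1), reassoc_of% hk, zero_comp])))
      (fun k hk => hker.fac _ WalkingParallelPair.zero)
      (fun k hk m hm => by
        rw [← cancel_mono (K.iCycles i)]
        exact hm.trans (hker.fac (KernelFork.ofι k _) WalkingParallelPair.zero).symm))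
  · rw [HomologicalComplex.exactAt_iff' _ i (i + 1) (i + 1 + 1) (by simp) (by simp)] at hK
    have hker' := K.cyclesIsKernel (i + 1) (i + 1 + 1) (by simp)
    let S := K.sc' i (i + 1) (i + 1 + 1)
    have hS : Epi S.toCycles := hK.epi_toCycles
    let e : S.cycles ≅ K.cycles (i + 1) :=
      IsLimit.conePointUniqueUpToIso S.cyclesIsKernel hker'
    have he : e.hom ≫ K.iCycles (i + 1) = S.iCycles :=
      IsLimit.conePointUniqueUpToIso_hom_comp S.cyclesIsKernel hker' WalkingParallelPair.zero
    let t : K.X i ⟶ S.cycles := S.toCycles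
    have ht : Epi t := hS
    have : K.toCycles i (i + 1) = t ≫ e.hom := by
      rw [← cancel_mono (K.iCycles (i + 1)), Category.assoc, he, K.toCycles_i]
      exact S.toCycles_i.symm
    change Epi (K.toCycles i (i + 1))
    rw [this]
    infer_instance

/-- In a complex of injectives that is exact beyond degree `b`, the injective dimension of the
cycles drops by one at each step. -/
theorem hasInjectiveDimensionLT_cycles (K : CochainComplex C ℤ) [∀ i, Injective (K.X i)]
    (b : ℤ) (hK : ∀ i, b < i → K.ExactAt i) (N : ℕ)
    (hN : HasInjectiveDimensionLT (K.cycles b) (N + 1)) (m j : ℕ) (hmj : m + j = N) :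
    HasInjectiveDimensionLT (K.cycles (b + m)) (j + 1) := by
  induction m generalizing j with
  | zero => obtain rfl : j = N := by lia
            simpa using hN
  | succ m ih =>
    have h := shortExact_cycles K (b + m) (hK _ (by lia))
    have := h.hasInjectiveDimensionLT_X₃ (j + 1)
      (hasInjectiveDimensionLT_of_ge (K.X (b + m)) 1 _ (by lia)) (ih (j + 1) (by lia))
    rwa [Nat.cast_succ, ← add_assoc]

variable [HasDerivedCategory C] [EnoughInjectives C]

/-- If the injective dimension of the objects of `C` is bounded, a bounded object of the derived
category is represented by a bounded complex of injectives: truncate an injective resolution in a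
degree where the cycles have become injective. -/
theorem exists_bounded_injective (N : ℕ) (hN : ∀ X : C, HasInjectiveDimensionLT X (N + 1))
    (I : DerivedCategory.Plus C) (b : ℤ) (hb : I.obj.IsLE b) :
    ∃ J : CochainComplex.Plus C, (∀ i, Injective (J.obj.X i)) ∧
      (∃ m : ℤ, J.obj.IsStrictlyLE m) ∧ Nonempty (I ≅ DerivedCategory.Plus.Q.obj J) := by
  obtain ⟨a, ha⟩ := I.property
  have : I.IsGE a := ⟨ha.1⟩
  obtain ⟨L, hL, ⟨e⟩⟩ := DerivedCategory.Plus.exists_injective_nonempty_iso I a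
  let K : CochainComplex.Plus C := (InjectiveObject.ι C).mapCochainComplexPlus.obj L
  have hKinj (i : ℤ) : Injective (K.obj.X i) := (L.obj.X i).property
  have hKGE : K.obj.IsStrictlyGE a :=
    (CochainComplex.isStrictlyGE_mapHomologicalComplex_obj_iff L.obj (InjectiveObject.ι C) a).2 hL
  have hKLE : K.obj.IsLE b := by
    rw [← DerivedCategory.isLE_Q_obj_iff]
    have : DerivedCategory.TStructure.t.IsLE (DerivedCategory.Plus.ι.obj I) b := hb
    exact DerivedCategory.TStructure.t.isLE_of_iso (DerivedCategory.Plus.ι.mapIso e.symm) b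
  let m : ℤ := b + N
  have hcyc : Injective (K.obj.cycles m) := by
    have := hasInjectiveDimensionLT_cycles K.obj b
      (fun i hi => K.obj.exactAt_of_isLE b i) N (hN _) N 0 (by simp)
    exact injective_iff_hasInjectiveDimensionLT_one.2 this
  have : K.obj.IsLE m := K.obj.isLE_of_le b m (by lia)
  let J : CochainComplex.Plus C := ⟨K.obj.truncLE m, a, inferInstance⟩
  let i : J ⟶ K := ObjectProperty.homMk (K.obj.ιTruncLE m)
  have : QuasiIso i.hom := inferInstanceAs (QuasiIso (K.obj.ιTruncLE m))
  obtain ⟨e'⟩ := nonempty_iso_Q_of_quasiIso i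
  have hJ : J.obj.IsStrictlyLE m := inferInstanceAs ((K.obj.truncLE m).IsStrictlyLE m)
  refine ⟨J, fun n => ?_, ⟨m, hJ⟩, ⟨e.symm ≪≫ e'.symm⟩⟩
  rcases lt_trichotomy n m with h | rfl | h
  · exact Injective.of_iso (K.obj.truncLEXIso m n h).symm (hKinj n)
  · exact Injective.of_iso (K.obj.truncLEXIsoCycles _).symm hcyc
  · exact Injective.of_iso (J.obj.isZero_of_isStrictlyLE m n).isoZero.symm inferInstance

end Bounded

/-! ### Short exact sequences of adjoint functors -/

section Adjoint

variable {C D : Type*} [Category* C] [Category* D] [Abelian C] [Abelian D]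
  {L₁ L₂ L₃ : D ⥤ C} {R₁ R₂ R₃ : C ⥤ D}
  (adj₁ : L₁ ⊣ R₁) (adj₂ : L₂ ⊣ R₂) (adj₃ : L₃ ⊣ R₃) (σ : L₁ ⟶ L₂) (τ : L₂ ⟶ L₃)

omit [Abelian C] [Abelian D] in
/-- Composition with the conjugate of `α` corresponds to precomposition with `α`. -/
theorem conjugateEquiv_homEquiv_symm {L L' : D ⥤ C} {R R' : C ⥤ D} (adj : L ⊣ R)
    (adj' : L' ⊣ R') (α : L' ⟶ L) {T : D} {F : C} (t : T ⟶ R.obj F) :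
    (adj'.homEquiv T F).symm (t ≫ (conjugateEquiv adj adj' α).app F) =
      α.app T ≫ (adj.homEquiv T F).symm t := by
  simp only [Adjunction.homEquiv_counit, Functor.map_comp, Category.assoc,
    conjugateEquiv_counit, NatTrans.naturality_assoc]

/-- A functorial short exact sequence `0 → L₁ T → L₂ T → L₃ T → 0` of left adjoints induces a
sequence `0 → R₃ F → R₂ F → R₁ F → 0` of right adjoints that is exact when `F` is injective:
maps from `T` into it are maps from `L₁ T`, `L₂ T`, `L₃ T` to `F`. -/
theorem shortExact_conjugate [∀ T, Mono (σ.app T)] [∀ T, Epi (τ.app T)]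
    (w : ∀ T, σ.app T ≫ τ.app T = 0)
    (hex : ∀ T, (ShortComplex.mk (σ.app T) (τ.app T) (w T)).Exact)
    (F : C) [Injective F] :
    ∃ w', (ShortComplex.mk ((conjugateEquiv adj₃ adj₂ τ).app F)
      ((conjugateEquiv adj₂ adj₁ σ).app F) w').ShortExact := by
  have := adj₁.isLeftAdjoint
  have := adj₃.isLeftAdjoint
  have w' : (conjugateEquiv adj₃ adj₂ τ).app F ≫ (conjugateEquiv adj₂ adj₁ σ).app F = 0 := by
    apply (adj₁.homEquiv _ _).symm.injective
    rw [conjugateEquiv_homEquiv_symm, ← Category.id_comp ((conjugateEquiv adj₃ adj₂ τ).app F),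
      conjugateEquiv_homEquiv_symm, reassoc_of% w, zero_comp, Adjunction.homEquiv_counit,
      Functor.map_zero, zero_comp]
  have hmono : Mono ((conjugateEquiv adj₃ adj₂ τ).app F) := by
    refine ⟨fun {T} s t hst => (adj₃.homEquiv T F).symm.injective ?_⟩
    rw [← cancel_epi (τ.app T), ← conjugateEquiv_homEquiv_symm adj₃ adj₂,
      ← conjugateEquiv_homEquiv_symm adj₃ adj₂, hst]
  refine ⟨w', { exact := ?_, mono_f := hmono, epi_g := ?_ }⟩
  · have lift (T : D) (t : T ⟶ R₂.obj F) (ht : t ≫ (conjugateEquiv adj₂ adj₁ σ).app F = 0) :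
        ∃ s : T ⟶ R₃.obj F, s ≫ (conjugateEquiv adj₃ adj₂ τ).app F = t := by
      -- `t` corresponds to a map `L₂ T ⟶ F` that vanishes on `L₁ T`
      have h : σ.app T ≫ (adj₂.homEquiv T F).symm t = 0 := by
        rw [← conjugateEquiv_homEquiv_symm adj₂ adj₁, ht, Adjunction.homEquiv_counit,
          Functor.map_zero, zero_comp]
      have hepi : Epi (ShortComplex.mk (σ.app T) (τ.app T) (w T)).g :=
        inferInstanceAs (Epi (τ.app T))
      have hd : τ.app T ≫ (hex T).desc _ h = (adj₂.homEquiv T F).symm t := (hex T).g_desc _ h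
      refine ⟨adj₃.homEquiv T F ((hex T).desc _ h), (adj₂.homEquiv T F).symm.injective ?_⟩
      rw [conjugateEquiv_homEquiv_symm, Equiv.symm_apply_apply, hd]
    refine ShortComplex.exact_of_f_is_kernel _ (KernelFork.IsLimit.ofι _ _
      (fun k hk => (lift _ k hk).choose) (fun k hk => (lift _ k hk).choose_spec)
      (fun k hk m hm => ?_))
    rw [← cancel_mono ((conjugateEquiv adj₃ adj₂ τ).app F)]
    exact hm.trans (lift _ k hk).choose_spec.symm
  · -- the counit `L₁ (R₁ F) ⟶ F` extends to `L₂ (R₁ F)`, which gives a section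
    let t := Injective.factorThru ((adj₁.homEquiv (R₁.obj F) F).symm (𝟙 _)) (σ.app (R₁.obj F))
    have ht : adj₂.homEquiv _ _ t ≫ (conjugateEquiv adj₂ adj₁ σ).app F = 𝟙 (R₁.obj F) := by
      apply (adj₁.homEquiv _ _).symm.injective
      rw [conjugateEquiv_homEquiv_symm, Equiv.symm_apply_apply, Injective.comp_factorThru]
    have : IsSplitEpi ((conjugateEquiv adj₂ adj₁ σ).app F) := ⟨⟨⟨_, ht⟩⟩⟩
    exact inferInstanceAs (Epi ((conjugateEquiv adj₂ adj₁ σ).app F))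

end Adjoint

/-! ### Graded dimensions and Morse inequalities -/

/-- The graded dimensions `b` and `s` satisfy the Morse inequalities: `s - b` is `(1 + t)` times a
series with natural coefficients `r j`, which is bounded by `s`. -/
def MorseRel (b s : ℤ → ℕ) : Prop :=
  ∃ r : ℤ → ℕ, ∀ j, s j = b j + r j + r (j - 1) ∧ r j ≤ s j

theorem MorseRel.congr {b b' s s' : ℤ → ℕ} (h : MorseRel b s) (hb : ∀ j, b j = b' j)
    (hs : ∀ j, s j = s' j) : MorseRel b' s' := by
  rwa [← funext hb, ← funext hs]

/-- Morse inequalities for all steps of the filtration of `P` by upper sets add up. -/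
theorem morseRel_sum {P : Type*} [PartialOrder P] [Fintype P]
    (h : (U : Set P) → IsUpperSet U → ℤ → ℕ) (c : P → ℤ → ℕ)
    (h0 : ∀ hU j, h ∅ hU j = 0)
    (step : ∀ (U V : Set P) (hU : IsUpperSet U) (hV : IsUpperSet V) (p : P), p ∉ U →
      V = insert p U → MorseRel (h V hV) (fun j => h U hU j + c p j)) :
    MorseRel (h Set.univ isUpperSet_univ) (fun j => ∑ p, c p j) := by
  classical
  suffices H : ∀ (S : Finset P) (hS : IsUpperSet (S : Set P)),
      MorseRel (h S hS) (fun j => ∑ p ∈ S, c p j) by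
    have key : ∀ (V : Set P) (hV : IsUpperSet V), V = (Finset.univ : Finset P) →
        MorseRel (h V hV) (fun j => ∑ p, c p j) := by
      rintro _ hV rfl
      exact H _ hV
    exact key _ _ Finset.coe_univ.symm
  intro S
  induction S using Finset.strongInduction with
  | H S ih =>
    intro hS
    rcases S.eq_empty_or_nonempty with rfl | hne
    · exact ⟨0, fun j => by simpa using (h0 (by simpa using hS) j).symm⟩
    · -- removing a minimal element leaves an upper set
      obtain ⟨p, hp⟩ := S.exists_minimal hne
      have hU : IsUpperSet ((S.erase p : Finset P) : Set P) := by
        intro x y hxy hx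
        simp only [Finset.coe_erase, Set.mem_sdiff, Finset.mem_coe, Set.mem_singleton_iff] at hx ⊢
        refine ⟨hS hxy hx.1, ?_⟩
        rintro rfl
        exact hx.2 (le_antisymm hxy (hp.le_of_le hx.1 hxy))
      obtain ⟨ρ, hρ⟩ := ih _ (Finset.erase_ssubset hp.1) hU
      obtain ⟨r, hr⟩ := step _ S hU hS p (by simp) (by
        rw [← Finset.coe_insert, Finset.insert_erase hp.1])
      refine ⟨fun j => r j + ρ j, fun j => ?_⟩
      have e := Finset.add_sum_erase S (fun p => c p j) hp.1
      have h₁ := hr j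
      have h₂ := hρ j
      dsimp only at e h₁ h₂ ⊢
      lia

/-- `∑_{j ≤ ℓ} (-1)^j s_j`, which is zero if infinitely many terms are nonzero. -/
def truncatedSum (ℓ : ℤ) (s : ℤ → ℕ) : ℤ := ∑ᶠ (j : ℤ) (_ : j ≤ ℓ), (j.negOnePow : ℤ) * (s j : ℤ)

/-- `∑_j (-1)^j s_j`, which is zero if infinitely many terms are nonzero. -/
def alternatingSum (s : ℤ → ℕ) : ℤ := ∑ᶠ j : ℤ, (j.negOnePow : ℤ) * (s j : ℤ)

theorem finite_support_alternating {s : ℤ → ℕ} (hs : s.support.Finite) :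
    (Function.support fun j : ℤ => (j.negOnePow : ℤ) * (s j : ℤ)).Finite :=
  hs.subset fun j hj => by
    simp only [Function.mem_support] at hj ⊢
    intro h
    simp [h] at hj

theorem truncatedSum_add (ℓ : ℤ) {s t : ℤ → ℕ} (hs : s.support.Finite) (ht : t.support.Finite) :
    truncatedSum ℓ (fun j => s j + t j) = truncatedSum ℓ s + truncatedSum ℓ t := by
  refine Eq.trans ?_ (finsum_mem_add_distrib' (s := Set.Iic ℓ)
    ((finite_support_alternating hs).subset Set.inter_subset_right)
    ((finite_support_alternating ht).subset Set.inter_subset_right))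
  simp only [truncatedSum, Set.mem_Iic, Nat.cast_add, mul_add]

theorem alternatingSum_add {s t : ℤ → ℕ} (hs : s.support.Finite) (ht : t.support.Finite) :
    alternatingSum (fun j => s j + t j) = alternatingSum s + alternatingSum t := by
  refine Eq.trans ?_ (finsum_add_distrib
    (finite_support_alternating hs) (finite_support_alternating ht))
  simp only [alternatingSum, Nat.cast_add, mul_add]

theorem finite_support_sum {P : Type*} (S : Finset P) (c : P → ℤ → ℕ)
    (hc : ∀ p, (c p).support.Finite) : (Function.support fun j => ∑ p ∈ S, c p j).Finite := by
  refine (S.finite_toSet.biUnion fun p _ => hc p).subset fun j hj => ?_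
  obtain ⟨p, hp, hpj⟩ := Finset.exists_ne_zero_of_sum_ne_zero hj
  exact Set.mem_biUnion hp hpj

theorem truncatedSum_sum (ℓ : ℤ) {P : Type*} (S : Finset P) (c : P → ℤ → ℕ)
    (hc : ∀ p, (c p).support.Finite) :
    truncatedSum ℓ (fun j => ∑ p ∈ S, c p j) = ∑ p ∈ S, truncatedSum ℓ (c p) := by
  classical
  induction S using Finset.induction_on with
  | empty => simp [truncatedSum]
  | insert p S hp ih =>
    simp only [Finset.sum_insert hp]
    rw [truncatedSum_add ℓ (hc p) (finite_support_sum S c hc), ih]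

theorem alternatingSum_sum {P : Type*} (S : Finset P) (c : P → ℤ → ℕ)
    (hc : ∀ p, (c p).support.Finite) :
    alternatingSum (fun j => ∑ p ∈ S, c p j) = ∑ p ∈ S, alternatingSum (c p) := by
  classical
  induction S using Finset.induction_on with
  | empty => simp [alternatingSum]
  | insert p S hp ih =>
    simp only [Finset.sum_insert hp]
    rw [alternatingSum_add (hc p) (finite_support_sum S c hc), ih]

theorem alternatingSum_shift (r : ℤ → ℕ) :
    alternatingSum (fun j => r (j - 1)) = -alternatingSum r := by
  unfold alternatingSum
  rw [← finsum_neg_distrib, ← finsum_comp_equiv (Equiv.subRight (1 : ℤ))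
    (f := fun j : ℤ => -((j.negOnePow : ℤ) * (r j : ℤ)))]
  refine finsum_congr fun j => ?_
  simp [Int.negOnePow_sub]

theorem truncatedSum_shift (ℓ : ℤ) (r : ℤ → ℕ) :
    truncatedSum ℓ (fun j => r (j - 1)) = -truncatedSum (ℓ - 1) r := by
  unfold truncatedSum
  rw [← finsum_neg_distrib, ← finsum_comp_equiv (Equiv.subRight (1 : ℤ))
    (f := fun j : ℤ => -∑ᶠ _ : j ≤ ℓ - 1, (j.negOnePow : ℤ) * (r j : ℤ))]
  refine finsum_congr fun j => ?_
  rw [← finsum_neg_distrib]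
  simp [Int.negOnePow_sub]

theorem truncatedSum_eq_add (ℓ : ℤ) {r : ℤ → ℕ} (hr : r.support.Finite) :
    truncatedSum ℓ r = (ℓ.negOnePow : ℤ) * r ℓ + truncatedSum (ℓ - 1) r := by
  have h : Set.Iic ℓ = insert ℓ (Set.Iic (ℓ - 1)) := by
    ext j; simp only [Set.mem_Iic, Set.mem_insert_iff]; lia
  have := finsum_mem_insert' (fun j : ℤ => (j.negOnePow : ℤ) * (r j : ℤ))
    (a := ℓ) (s := Set.Iic (ℓ - 1)) (by simp)
    ((finite_support_alternating hr).subset Set.inter_subset_right)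
  rw [← h] at this
  exact this

theorem finsum_mem_truncatedSum (ℓ : ℤ) {P : Type*} [Fintype P] (c : P → ℤ → ℕ) (K : Set P)
    (hK : ∀ p ∉ K, ∀ j, c p j = 0) :
    ∑ᶠ p ∈ K, truncatedSum ℓ (c p) = ∑ p, truncatedSum ℓ (c p) := by
  rw [← finsum_eq_sum_of_fintype]
  refine finsum_congr fun p => ?_
  by_cases hp : p ∈ K
  · simp [hp]
  · simp [hp, truncatedSum, hK p hp]

theorem finsum_mem_alternatingSum {P : Type*} [Fintype P] (c : P → ℤ → ℕ) (K : Set P)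
    (hK : ∀ p ∉ K, ∀ j, c p j = 0) :
    ∑ᶠ p ∈ K, alternatingSum (c p) = ∑ p, alternatingSum (c p) := by
  rw [← finsum_eq_sum_of_fintype]
  refine finsum_congr fun p => ?_
  by_cases hp : p ∈ K
  · simp [hp]
  · simp [hp, alternatingSum, hK p hp]

variable {b s : ℤ → ℕ}

theorem MorseRel.truncatedSum_le (h : MorseRel b s) (hs : s.support.Finite) (ℓ : ℤ) :
    (ℓ.negOnePow : ℤ) * truncatedSum ℓ b ≤ (ℓ.negOnePow : ℤ) * truncatedSum ℓ s := by
  obtain ⟨r, hr⟩ := h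
  have hrf : r.support.Finite := hs.subset fun j hj => by
    have := hr j; simp only [Function.mem_support] at hj ⊢; lia
  have hbf : b.support.Finite := hs.subset fun j hj => by
    have := hr j; simp only [Function.mem_support] at hj ⊢; lia
  have hrf' : (fun j => r (j - 1)).support.Finite := hs.subset fun j hj => by
    have := hr j; simp only [Function.mem_support] at hj ⊢; lia
  obtain rfl : s = fun j => b j + (r j + r (j - 1)) := funext fun j => by have := hr j; lia
  rw [truncatedSum_add ℓ hbf ((hrf.union hrf').subset (Function.support_add r _)),
    truncatedSum_add ℓ hrf hrf', truncatedSum_shift, truncatedSum_eq_add ℓ hrf, mul_add]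
  have : ((ℓ.negOnePow : ℤˣ) : ℤ) * (ℓ.negOnePow : ℤˣ) = 1 := by
    rw [← Units.val_mul, Int.units_mul_self, Units.val_one]
  rw [add_neg_cancel_right, ← mul_assoc, this, one_mul]
  lia

theorem MorseRel.alternatingSum_eq (h : MorseRel b s) (hs : s.support.Finite) :
    alternatingSum b = alternatingSum s := by
  obtain ⟨r, hr⟩ := h
  have hrf : r.support.Finite := hs.subset fun j hj => by
    have := hr j; simp only [Function.mem_support] at hj ⊢; lia
  have hbf : b.support.Finite := hs.subset fun j hj => by
    have := hr j; simp only [Function.mem_support] at hj ⊢; lia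
  have hrf' : (fun j => r (j - 1)).support.Finite := hs.subset fun j hj => by
    have := hr j; simp only [Function.mem_support] at hj ⊢; lia
  obtain rfl : s = fun j => b j + (r j + r (j - 1)) := funext fun j => by have := hr j; lia
  rw [alternatingSum_add hbf ((hrf.union hrf').subset (Function.support_add r _)),
    alternatingSum_add hrf hrf', alternatingSum_shift, add_neg_cancel, add_zero]

/-- The Morse inequalities and the Euler characteristic formula, with the sums on the right taken
over a set `K` outside of which the contributions `c p` vanish. -/
theorem MorseRel.inequalities {P : Type*} [Fintype P] {c : P → ℤ → ℕ}
    (h : MorseRel b (fun j => ∑ p, c p j)) (hc : ∀ p, (c p).support.Finite) (K : Set P)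
    (hK : ∀ p ∉ K, ∀ j, c p j = 0) :
    (∀ ℓ : ℤ, (ℓ.negOnePow : ℤ) * truncatedSum ℓ b ≤
      (ℓ.negOnePow : ℤ) * ∑ᶠ p ∈ K, truncatedSum ℓ (c p)) ∧
    alternatingSum b = ∑ᶠ p ∈ K, alternatingSum (c p) := by
  have hs := finite_support_sum Finset.univ c hc
  refine ⟨fun ℓ => ?_, ?_⟩
  · rw [finsum_mem_truncatedSum ℓ c K hK, ← truncatedSum_sum ℓ _ c hc]
    exact h.truncatedSum_le hs ℓ
  · rw [finsum_mem_alternatingSum c K hK, ← alternatingSum_sum _ c hc]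
    exact h.alternatingSum_eq hs

/-! ### Dimensions in a distinguished triangle -/

section Dimension

open Pretriangulated

variable {k : Type u} [Field k]

theorem finrank_eq_of_iso {V W : FGModuleCat.{u} k} (e : V ≅ W) :
    Module.finrank k V = Module.finrank k W :=
  (FGModuleCat.isoToLinearEquiv e).finrank_eq

theorem finrank_eq_zero_of_isZero {V : FGModuleCat.{u} k} (h : IsZero V) :
    Module.finrank k V = 0 := by
  have : Subsingleton V := ModuleCat.subsingleton_of_isZero
    ((forget₂ (FGModuleCat.{u} k) (ModuleCat.{u} k)).map_isZero h)
  exact Module.finrank_zero_of_subsingleton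

/-- The rank of a morphism of finite-dimensional vector spaces. -/
def rank {V W : FGModuleCat.{u} k} (f : V ⟶ W) : ℕ :=
  Module.finrank k (LinearMap.range f.hom.hom)

theorem finrank_eq_rank_add_rank {U V W : FGModuleCat.{u} k} {f : U ⟶ V} {g : V ⟶ W}
    {w : f ≫ g = 0} (h : (ShortComplex.mk f g w).Exact) :
    Module.finrank k V = rank f + rank g := by
  have h' := (h.map (forget₂ (FGModuleCat.{u} k) (ModuleCat.{u} k))).moduleCat_range_eq_ker
  have h'' : LinearMap.range f.hom.hom = LinearMap.ker g.hom.hom := h'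
  rw [rank, rank, h'', add_comm]
  exact (LinearMap.finrank_range_add_finrank_ker g.hom.hom).symm

theorem rank_le {V W : FGModuleCat.{u} k} (f : V ⟶ W) : rank f ≤ Module.finrank k V :=
  LinearMap.finrank_range_le f.hom.hom

/-- The dimension of the `j`-th cohomology. -/
def cohomologyDim (j : ℤ) (K : DerivedCategory (FGModuleCat.{u} k)) : ℕ :=
  Module.finrank k ((DerivedCategory.homologyFunctor (FGModuleCat.{u} k) j).obj K)

theorem cohomologyDim_eq_of_iso (j : ℤ) {K L : DerivedCategory (FGModuleCat.{u} k)} (e : K ≅ L) :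
    cohomologyDim j K = cohomologyDim j L :=
  finrank_eq_of_iso ((DerivedCategory.homologyFunctor (FGModuleCat.{u} k) j).mapIso e)

/-- The long exact cohomology sequence gives Morse inequalities, in which the remainder is the
rank of the connecting homomorphism. -/
theorem morseRel_of_distTriang (T : Triangle (DerivedCategory (FGModuleCat.{u} k)))
    (hT : T ∈ distTriang _) :
    MorseRel (fun j => cohomologyDim j T.obj₂)
      (fun j => cohomologyDim j T.obj₁ + cohomologyDim j T.obj₃) := by
  refine ⟨fun j => rank (DerivedCategory.HomologySequence.δ T j (j + 1)), fun j => ?_⟩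
  have h₁ := finrank_eq_rank_add_rank
    (DerivedCategory.HomologySequence.exact₁ T hT (j - 1) j (by lia))
  have h₂ := finrank_eq_rank_add_rank (DerivedCategory.HomologySequence.exact₂ T hT j)
  have h₃ := finrank_eq_rank_add_rank
    (DerivedCategory.HomologySequence.exact₃ T hT j (j + 1) (by lia))
  have h₄ : rank (DerivedCategory.HomologySequence.δ T j (j + 1)) ≤
    cohomologyDim j T.obj₃ := rank_le _
  have key : ∀ (m : ℤ) (_ : m = j) (h : j - 1 + 1 = m),
      rank (DerivedCategory.HomologySequence.δ T (j - 1) m h) =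
        rank (DerivedCategory.HomologySequence.δ T (j - 1) j (by lia)) := by
    rintro _ rfl _
    rfl
  have h₅ := key _ (by lia) rfl
  unfold cohomologyDim at h₄ ⊢
  lia

end Dimension

/-! ### Extension by zero and sections with support -/

section Sheaves

variable {k : Type u} [Field k] {X : Type v} [PartialOrder X]

theorem isZero_of_subsingleton {V : FGModuleCat.{u} k} (h : Subsingleton V) : IsZero V := by
  rw [IsZero.iff_id_eq_zero]
  ext x
  exact Subsingleton.elim _ _

theorem mono_of_injective {V W : FGModuleCat.{u} k} (f : V ⟶ W)
    (hf : Function.Injective f.hom.hom) : Mono f :=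
  (forget₂ (FGModuleCat.{u} k) (ModuleCat.{u} k)).mono_of_mono_map
    ((ModuleCat.mono_iff_injective _).2 hf)

theorem injective_of_mono {V W : FGModuleCat.{u} k} (f : V ⟶ W) [Mono f] :
    Function.Injective f.hom.hom :=
  have : Mono ((forget₂ (FGModuleCat.{u} k) (ModuleCat.{u} k)).map f) := inferInstance
  (ModuleCat.mono_iff_injective _).1 this

theorem epi_of_surjective {V W : FGModuleCat.{u} k} (f : V ⟶ W)
    (hf : Function.Surjective f.hom.hom) : Epi f :=
  (forget₂ (FGModuleCat.{u} k) (ModuleCat.{u} k)).epi_of_epi_map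
    ((ModuleCat.epi_iff_surjective _).2 hf)

theorem exact_of_forall_exists {U V W : FGModuleCat.{u} k} {f : U ⟶ V} {g : V ⟶ W}
    (w : f ≫ g = 0) (h : ∀ v, g.hom.hom v = 0 → ∃ u, f.hom.hom u = v) :
    (ShortComplex.mk f g w).Exact := by
  rw [← ShortComplex.exact_map_iff_of_faithful _ (forget₂ (FGModuleCat.{u} k) (ModuleCat.{u} k)),
    ShortComplex.moduleCat_exact_iff]
  exact h

theorem exact_of_exact_app {S : ShortComplex (PosetSheaf k X)}
    (h : ∀ x, (S.map ((evaluation X (FGModuleCat.{u} k)).obj x)).Exact) : S.Exact := by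
  rw [ShortComplex.exact_iff_isZero_homology, Functor.isZero_iff]
  intro x
  have := (ShortComplex.exact_iff_isZero_homology _).1 (h x)
  exact this.of_iso (S.mapHomologyIso ((evaluation X (FGModuleCat.{u} k)).obj x)).symm

section Adjunction

variable {Z : Set X}

theorem subsingleton_extVal {F : PosetSheaf k Z} {x : X} (hx : x ∉ Z) :
    Subsingleton (ExtVal F x) :=
  ⟨fun _ _ => funext fun h => absurd h.down hx⟩

/-- `F(z)` is the value at `z ∈ Z` of the extension by zero of `F`. -/
def toExtVal (F : PosetSheaf k Z) (z : Z) : F.obj z →ₗ[k] ExtVal F z.1 :=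
  LinearMap.pi fun _ => LinearMap.id

theorem extMap_toExtVal (F : PosetSheaf k Z) {z z' : Z} (h : z ≤ z') (v : F.obj z) :
    extMap F (show z.1 ≤ z'.1 from h) (toExtVal F z v) =
      toExtVal F z' ((F.map (homOfLE h)).hom.hom v) :=
  funext fun hz => extMap_of_mem F _ _ z.2 hz

open Classical in
/-- The value at `x` of the sheaf map `i_{Z!} F ⟶ G` attached to `ψ : F ⟶ i_Z^! G`. -/
def extDesc {F : PosetSheaf k Z} {G : PosetSheaf k X} (ψ : F ⟶ (properPullback k Z).obj G)
    (x : X) : ExtVal F x →ₗ[k] G.obj x :=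
  if hx : x ∈ Z then
    (supportedAt Z G x).subtype.comp
      ((ψ.app ⟨x, hx⟩).hom.hom.comp (LinearMap.proj (PLift.up hx)))
  else 0

theorem extDesc_of_mem {F : PosetSheaf k Z} {G : PosetSheaf k X}
    (ψ : F ⟶ (properPullback k Z).obj G) {x : X} (hx : x ∈ Z) (v : ExtVal F x) :
    extDesc ψ x v = ((ψ.app ⟨x, hx⟩).hom.hom (v ⟨hx⟩) : supportedAt Z G x).1 := by
  rw [extDesc, dif_pos hx]
  rfl

theorem extDesc_of_notMem {F : PosetSheaf k Z} {G : PosetSheaf k X}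
    (ψ : F ⟶ (properPullback k Z).obj G) {x : X} (hx : x ∉ Z) (v : ExtVal F x) :
    extDesc ψ x v = 0 := by
  rw [extDesc, dif_neg hx]
  rfl

/-- Extension by zero is left adjoint to the proper pullback. -/
def properAdjunction (hZ : LocallyClosed Z) : properPushforward k hZ ⊣ properPullback k Z :=
  Adjunction.mkOfHomEquiv
    { homEquiv := fun F G =>
        { toFun := fun φ =>
            { app := fun z => FGModuleCat.ofHom
                (((φ.app z.1).hom.hom.comp (toExtVal F z)).codRestrict (supportedAt Z G z.1)
                  (by
                    intro v y h hy
                    have := subsingleton_extVal (F := F) hy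
                    have e := congrArg (fun g => g.hom.hom (toExtVal F z v))
                      (φ.naturality (homOfLE h))
                    refine e.symm.trans ?_
                    exact (congrArg (φ.app y).hom.hom (Subsingleton.elim
                      (extMap F h (toExtVal F z v)) 0)).trans (map_zero _)))
              naturality := by
                intro z z' f
                refine FGModuleCat.hom_ext (LinearMap.ext fun v => Subtype.ext ?_)
                have e := congrArg (fun g => g.hom.hom (toExtVal F z v))
                  (φ.naturality (homOfLE (show z.1 ≤ z'.1 from leOfHom f)))
                refine Eq.trans ?_ e
                exact congrArg (φ.app z'.1).hom.hom (extMap_toExtVal F (leOfHom f) v).symm }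
          invFun := fun ψ =>
            { app := fun x => FGModuleCat.ofHom (extDesc ψ x)
              naturality := by
                intro x y f
                refine FGModuleCat.hom_ext (LinearMap.ext fun (v : ExtVal F x) => ?_)
                change extDesc ψ y (extMap F (leOfHom f) v) =
                  (G.map f).hom.hom (extDesc ψ x v)
                by_cases hx : x ∈ Z
                · rw [extDesc_of_mem ψ hx]
                  by_cases hy : y ∈ Z
                  · rw [extDesc_of_mem ψ hy, extMap_of_mem F _ v hx]
                    exact congrArg (fun g => (g.hom.hom (v ⟨hx⟩) : supportedAt Z G y).1)
                      (ψ.naturality (homOfLE (show (⟨x, hx⟩ : Z) ≤ ⟨y, hy⟩ from leOfHom f)))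
                  · rw [extDesc_of_notMem ψ hy]
                    exact (((ψ.app ⟨x, hx⟩).hom.hom (v ⟨hx⟩) : supportedAt Z G x).2 y
                      (leOfHom f) hy).symm
                · have := subsingleton_extVal (F := F) hx
                  rw [Subsingleton.elim v 0]
                  simp only [map_zero] }
          left_inv := by
            intro φ
            refine NatTrans.ext (funext fun x => FGModuleCat.hom_ext
              (LinearMap.ext fun (v : ExtVal F x) => ?_))
            change extDesc _ x v = (φ.app x).hom.hom v
            by_cases hx : x ∈ Z
            · rw [extDesc_of_mem _ hx]
              rfl
            · have := subsingleton_extVal (F := F) hx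
              rw [Subsingleton.elim v 0]
              exact (map_zero _).trans (map_zero _).symm
          right_inv := by
            intro ψ
            refine NatTrans.ext (funext fun z => FGModuleCat.hom_ext (LinearMap.ext fun v =>
              Subtype.ext ?_))
            exact extDesc_of_mem ψ z.2 (toExtVal F z v) }
      homEquiv_naturality_left_symm := by
        intro F F' G f ψ
        refine NatTrans.ext (funext fun x => FGModuleCat.hom_ext
          (LinearMap.ext fun (v : ExtVal F x) => ?_))
        change extDesc (f ≫ ψ) x v =
          extDesc ψ x (fun h => (f.app ⟨x, h.down⟩).hom.hom (v h))
        by_cases hx : x ∈ Z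
        · rw [extDesc_of_mem _ hx, extDesc_of_mem _ hx]
          rfl
        · rw [extDesc_of_notMem _ hx, extDesc_of_notMem _ hx]
      homEquiv_naturality_right := by
        intro F G G' φ g
        rfl }

instance (hZ : LocallyClosed Z) : (properPushforward k hZ).PreservesMonomorphisms where
  preserves {F G} η hη := by
    have (x : X) : Mono (((properPushforward k hZ).map η).app x) := by
      refine mono_of_injective _ fun v v' h => funext fun hx => ?_
      have : Mono (η.app ⟨x, hx.down⟩) := inferInstance
      exact injective_of_mono _ (congrFun h hx)
    exact NatTrans.mono_of_mono_app _

instance (hZ : LocallyClosed Z) : (properPushforward k hZ).PreservesHomology := by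
  have : (properPushforward k hZ).IsLeftAdjoint := (properAdjunction (k := k) hZ).isLeftAdjoint
  have := (properAdjunction (k := k) hZ).leftAdjoint_preservesColimits.{0, 0}
  exact Functor.preservesHomology_of_preservesMonos_and_cokernels _

instance (Z : Set X) : (sheafPullback k Z).PreservesHomology := by
  have : PreservesFiniteLimits (sheafPullback k Z) := by
    unfold sheafPullback; infer_instance
  have : PreservesFiniteColimits (sheafPullback k Z) := by
    unfold sheafPullback; infer_instance
  infer_instance

theorem injective_properPullback (hZ : LocallyClosed Z) (F : PosetSheaf k X) [Injective F] :
    Injective ((properPullback k Z).obj F) :=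
  Injective.injective_of_adjoint (properAdjunction hZ) F

end Adjunction

end Sheaves

/-! ### The short exact sequence of an open subset -/

section Restriction

variable {k : Type u} [Field k] {X : Type v} [PartialOrder X]

variable (k) in
/-- The sheaf `i_{Z!} i_Z^* F` that agrees with `F` on `Z` and is zero elsewhere. -/
abbrev extendRestrict {Z : Set X} (hZ : LocallyClosed Z) : PosetSheaf k X ⥤ PosetSheaf k X :=
  sheafPullback k Z ⋙ properPushforward k hZ

variable {A B Z : Set X}

open Classical in
/-- The map `F(x) → F(x)` that is the identity if `x ∈ A ∩ B`, and zero otherwise, from the value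
of the extension by zero of `F|_A` to that of `F|_B`. -/
def compareVal (A B : Set X) (F : PosetSheaf k X) (x : X) :
    ExtVal ((sheafPullback k A).obj F) x →ₗ[k] ExtVal ((sheafPullback k B).obj F) x :=
  LinearMap.pi fun _ => if h : x ∈ A then LinearMap.proj (PLift.up h) else 0

theorem compareVal_of_mem (F : PosetSheaf k X) {x : X} (hA : x ∈ A) (hB : PLift (x ∈ B))
    (v : ExtVal ((sheafPullback k A).obj F) x) : compareVal A B F x v hB = v ⟨hA⟩ := by
  simp [compareVal, hA]
  rfl

theorem compareVal_of_notMem (F : PosetSheaf k X) {x : X} (hA : x ∉ A) (hB : PLift (x ∈ B))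
    (v : ExtVal ((sheafPullback k A).obj F) x) : compareVal A B F x v hB = 0 := by
  simp [compareVal, hA]

theorem compareVal_extMap (h : ∀ x y, x ≤ y → x ∈ A → y ∈ B → (y ∈ A ↔ x ∈ B))
    (F : PosetSheaf k X) {x y : X} (hxy : x ≤ y) (v : ExtVal ((sheafPullback k A).obj F) x) :
    compareVal A B F y (extMap _ hxy v) = extMap _ hxy (compareVal A B F x v) := by
  funext hy
  by_cases hxA : x ∈ A
  · by_cases hyA : y ∈ A
    · have hxB := (h x y hxy hxA hy.down).1 hyA
      rw [compareVal_of_mem F hyA, extMap_of_mem _ _ _ hxA, extMap_of_mem _ _ _ hxB,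
        compareVal_of_mem F hxA]
      rfl
    · have hxB : x ∉ B := fun hxB => hyA ((h x y hxy hxA hy.down).2 hxB)
      rw [compareVal_of_notMem F hyA, extMap_of_notMem _ _ _ hxB]
  · by_cases hyA : y ∈ A
    · rw [compareVal_of_mem F hyA, extMap_of_notMem _ _ _ hxA]
      by_cases hxB : x ∈ B
      · rw [extMap_of_mem _ _ _ hxB, compareVal_of_notMem F hxA, map_zero]
        rfl
      · rw [extMap_of_notMem _ _ _ hxB]
        rfl
    · rw [compareVal_of_notMem F hyA]
      by_cases hxB : x ∈ B
      · rw [extMap_of_mem _ _ _ hxB, compareVal_of_notMem F hxA, map_zero]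
      · rw [extMap_of_notMem _ _ _ hxB]

/-- The natural map `F_A ⟶ F_B` between extensions by zero of restrictions that is the identity on
`A ∩ B`. The condition holds if `A` is an open subset of `B`, or `B` a closed subset of `A`. -/
def compare (hA : LocallyClosed A) (hB : LocallyClosed B)
    (h : ∀ x y, x ≤ y → x ∈ A → y ∈ B → (y ∈ A ↔ x ∈ B)) :
    extendRestrict k hA ⟶ extendRestrict k hB where
  app F :=
    { app := fun x => FGModuleCat.ofHom (compareVal A B F x)
      naturality := fun x y f => FGModuleCat.hom_ext
        (LinearMap.ext fun v => compareVal_extMap h F (leOfHom f) v) }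
  naturality F G φ := by
    refine NatTrans.ext (funext fun x => FGModuleCat.hom_ext (LinearMap.ext
      fun (v : ExtVal ((sheafPullback k A).obj F) x) => funext fun hb => ?_))
    by_cases hx : x ∈ A
    · refine (compareVal_of_mem G hx hb _).trans ?_
      exact congrArg (φ.app x).hom.hom (compareVal_of_mem F hx hb v).symm
    · refine (compareVal_of_notMem G hx hb _).trans ?_
      exact ((congrArg (φ.app x).hom.hom (compareVal_of_notMem F hx hb v)).trans
        (map_zero _)).symm

section Step

variable {U V Z : Set X} (hU : LocallyClosed U) (hV : LocallyClosed V) (hZ : LocallyClosed Z)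

theorem compare_condition_open (hU' : IsUpperSet U) (hUV : U ⊆ V) :
    ∀ x y, x ≤ y → x ∈ U → y ∈ V → (y ∈ U ↔ x ∈ V) :=
  fun _ _ hxy hx _ => ⟨fun _ => hUV hx, fun _ => hU' hxy hx⟩

theorem compare_condition_closed (hU' : IsUpperSet U) (hUV : V = U ∪ Z) (hd : Disjoint U Z) :
    ∀ x y, x ≤ y → x ∈ V → y ∈ Z → (y ∈ V ↔ x ∈ Z) := by
  rintro x y hxy hx hy
  refine ⟨fun _ => ?_, fun _ => hUV ▸ Or.inr hy⟩
  rw [hUV] at hx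
  exact hx.resolve_left fun h => hd.le_bot ⟨hU' hxy h, hy⟩

/-- For an open set `V` that is the disjoint union of an open set `U` and of `Z`, the sequence
`0 → F_U → F_V → F_Z → 0` is exact. -/
theorem shortExact_compare (hU' : IsUpperSet U) (hUV : V = U ∪ Z) (hd : Disjoint U Z) :
    ∃ (h₁ : ∀ x y, x ≤ y → x ∈ U → y ∈ V → (y ∈ U ↔ x ∈ V))
      (h₂ : ∀ x y, x ≤ y → x ∈ V → y ∈ Z → (y ∈ V ↔ x ∈ Z))
      (w : compare (k := k) hU hV h₁ ≫ compare hV hZ h₂ = 0),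
      ∀ F, (ShortComplex.mk ((compare hU hV h₁).app F) ((compare hV hZ h₂).app F)
        (NatTrans.congr_app w F)).ShortExact := by
  have hUV' : U ⊆ V := hUV ▸ Set.subset_union_left
  have hZV : Z ⊆ V := hUV ▸ Set.subset_union_right
  refine ⟨compare_condition_open hU' hUV', compare_condition_closed hU' hUV hd, ?_, ?_⟩
  · refine NatTrans.ext (funext fun F => NatTrans.ext (funext fun x => FGModuleCat.hom_ext
      (LinearMap.ext fun (v : ExtVal ((sheafPullback k U).obj F) x) => funext fun hz => ?_)))
    refine (compareVal_of_mem F (hZV hz.down) hz _).trans ?_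
    exact compareVal_of_notMem F (fun h => hd.le_bot ⟨h, hz.down⟩) _ v
  · intro F
    have hmono (x : X) : Mono (((compare (k := k) hU hV
        (compare_condition_open hU' hUV')).app F).app x) := by
      refine mono_of_injective _ fun v v' h => funext fun hx => ?_
      have := congrFun h ⟨hUV' hx.down⟩
      exact (compareVal_of_mem F hx.down ⟨hUV' hx.down⟩ v).symm.trans
        (Eq.trans this (compareVal_of_mem F hx.down _ v'))
    have hepi (x : X) : Epi (((compare (k := k) hV hZ
        (compare_condition_closed hU' hUV hd)).app F).app x) := by
      refine epi_of_surjective _ fun v => ?_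
      by_cases hx : x ∈ Z
      · exact ⟨fun _ => v ⟨hx⟩, funext fun hz => compareVal_of_mem F (hZV hx) hz _⟩
      · have := subsingleton_extVal (F := (sheafPullback k Z).obj F) hx
        exact ⟨0, Subsingleton.elim (α := ExtVal ((sheafPullback k Z).obj F) x) _ _⟩
    refine { exact := exact_of_exact_app fun x => ?_, mono_f := ?_, epi_g := ?_ }
    · refine exact_of_forall_exists _ fun (v : ExtVal ((sheafPullback k V).obj F) x)
        (hv : compareVal V Z F x v = 0) => ?_
      refine ⟨compareVal V U F x v, funext fun hx => ?_⟩
      change compareVal U V F x (compareVal V U F x v) hx = v hx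
      by_cases hxU : x ∈ U
      · rw [compareVal_of_mem F hxU, compareVal_of_mem F hx.down]
      · have hxZ : x ∈ Z := (hUV ▸ hx.down : x ∈ U ∪ Z).resolve_left hxU
        rw [compareVal_of_notMem F hxU]
        exact (congrFun hv ⟨hxZ⟩).symm.trans (compareVal_of_mem F hx.down _ v)
    · exact NatTrans.mono_of_mono_app _
    · exact NatTrans.epi_of_epi_app _

end Step

theorem isZero_extendRestrict (hZ : LocallyClosed Z) (h : Z = ∅) (F : PosetSheaf k X) :
    IsZero ((extendRestrict k hZ).obj F) := by
  rw [Functor.isZero_iff]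
  exact fun x => isZero_of_subsingleton (subsingleton_extVal (by simp [h]))

/-- Restricting to the whole poset and extending back does nothing. -/
def extendRestrictUniv (hZ : LocallyClosed Z) (h : Z = Set.univ) :
    extendRestrict k hZ ≅ 𝟭 (PosetSheaf k X) :=
  have hx (x : X) : x ∈ Z := h ▸ Set.mem_univ x
  NatIso.ofComponents
    (fun F => NatIso.ofComponents
      (fun x => LinearEquiv.toFGModuleCatIso
        ({ toFun := fun v => v ⟨hx x⟩
           invFun := fun v _ => v
           map_add' := fun _ _ => rfl
           map_smul' := fun _ _ => rfl
           left_inv := fun _ => rfl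
           right_inv := fun _ => rfl } : ExtVal ((sheafPullback k Z).obj F) x ≃ₗ[k] F.obj x))
      (fun {x y} f => FGModuleCat.hom_ext (LinearMap.ext fun v =>
        extMap_of_mem _ (leOfHom f) v (hx x) ⟨hx y⟩)))
    (fun _ => rfl)

variable [Finite X]

/-- `Γ(Z, i_Z^! F)`; for open `Z` this is the space of sections of `F` over `Z`. -/
abbrev sectionsWithSupport (Z : Set X) : PosetSheaf k X ⥤ FGModuleCat.{u} k :=
  properPullback k Z ⋙ globalSections k Z

/-- Maps from `T` to `Γ(Z, i_Z^! F)` are the maps to `F` from the extension by zero of the constant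
sheaf `T` on `Z`. -/
def sectionsAdjunction (hZ : LocallyClosed Z) :
    Functor.const X ⋙ extendRestrict k hZ ⊣ sectionsWithSupport (k := k) Z :=
  (constLimAdj.comp (properAdjunction hZ)).ofNatIsoLeft
    (NatIso.ofComponents fun _ => Iso.refl _)

theorem shortExact_sections {U V : Set X} (hU : LocallyClosed U) (hV : LocallyClosed V)
    (hZ : LocallyClosed Z) (hU' : IsUpperSet U) (hUV : V = U ∪ Z) (hd : Disjoint U Z) :
    ∃ (α : sectionsWithSupport (k := k) Z ⟶ sectionsWithSupport V)
      (β : sectionsWithSupport (k := k) V ⟶ sectionsWithSupport U),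
      ∀ (F : PosetSheaf k X) [Injective F], ∃ w,
        (ShortComplex.mk (α.app F) (β.app F) w).ShortExact := by
  obtain ⟨h₁, h₂, w, H⟩ := shortExact_compare (k := k) hU hV hZ hU' hUV hd
  let σ := Functor.whiskerLeft (Functor.const X) (compare (k := k) hU hV h₁)
  let τ := Functor.whiskerLeft (Functor.const X) (compare (k := k) hV hZ h₂)
  refine ⟨conjugateEquiv (sectionsAdjunction hZ) (sectionsAdjunction hV) τ,
    conjugateEquiv (sectionsAdjunction hV) (sectionsAdjunction hU) σ, fun F _ => ?_⟩
  have (T : FGModuleCat.{u} k) : Mono (σ.app T) := (H ((Functor.const X).obj T)).mono_f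
  have (T : FGModuleCat.{u} k) : Epi (τ.app T) := (H ((Functor.const X).obj T)).epi_g
  exact shortExact_conjugate _ _ _ σ τ
    (fun T => NatTrans.congr_app w ((Functor.const X).obj T)) (fun T => (H _).exact) F

theorem isZero_sections (hZ : LocallyClosed Z) (h : Z = ∅) (F : PosetSheaf k X) :
    IsZero ((sectionsWithSupport Z).obj F) := by
  have h0 := isZero_extendRestrict hZ h ((Functor.const X).obj ((sectionsWithSupport Z).obj F))
  rw [IsZero.iff_id_eq_zero]
  exact ((sectionsAdjunction hZ).homEquiv _ F).symm.injective (h0.eq_of_src _ _)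

/-- Over the whole poset there is no support condition. -/
def sectionsUniv (hZ : LocallyClosed Z) (h : Z = Set.univ) :
    globalSections k X ≅ sectionsWithSupport (k := k) Z :=
  conjugateIsoEquiv constLimAdj (sectionsAdjunction hZ)
    (Functor.isoWhiskerLeft (Functor.const X) (extendRestrictUniv hZ h) ≪≫
      Functor.rightUnitor _)

end Restriction

/-! ### Injective dimension -/

section InjectiveDimension

variable {k : Type u} [Field k] {X : Type v} [PartialOrder X]

/-- Sheaves supported on a closed set `S` have injective dimension at most `|S|`: for `m` maximal
in `S`, the kernel and the cokernel of the unit map from `F` to the injective sheaf with value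
`F(m)` at all `x ≤ m` are supported on `S \ {m}`. -/
theorem hasInjectiveDimensionLT_of_support (S : Finset X) (hS : IsLowerSet (S : Set X))
    (F : PosetSheaf k X) (hF : ∀ x, x ∉ S → IsZero (F.obj x)) :
    HasInjectiveDimensionLT F (S.card + 1) := by
  classical
  induction S using Finset.strongInduction generalizing F with
  | H S ih =>
    rcases S.eq_empty_or_nonempty with rfl | hne
    · have : IsZero F := by
        rw [Functor.isZero_iff]
        exact fun x => hF x (by simp)
      have := this.hasInjectiveDimensionLT_zero
      exact hasInjectiveDimensionLT_of_ge F 0 _ (by simp)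
    · obtain ⟨m, hm⟩ := S.exists_maximal hne
      have hS' : IsLowerSet ((S.erase m : Finset X) : Set X) := by
        intro x y hyx hx
        simp only [Finset.coe_erase, Set.mem_sdiff, Finset.mem_coe, Set.mem_singleton_iff] at hx ⊢
        refine ⟨hS hyx hx.1, ?_⟩
        rintro rfl
        exact hx.2 (le_antisymm (hm.le_of_ge hx.1 hyx) hyx)
      have hcard : (S.erase m).card + 1 = S.card := Finset.card_erase_add_one hm.1
      let adj := evaluationAdjunctionLeft (FGModuleCat.{u} k) m
      let R : PosetSheaf k X := (evaluationRightAdjoint (FGModuleCat.{u} k) m).obj (F.obj m)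
      have hR : Injective R := Injective.injective_of_adjoint adj (F.obj m)
      let φ : F ⟶ R := adj.unit.app F
      -- the value of `R` at `x` is a product over the proofs of `x ≤ m`
      have hRx (x : X) (hx : ¬ x ≤ m) : IsZero (R.obj x) := by
        rw [IsZero.iff_id_eq_zero]
        exact Pi.hom_ext _ _ fun g => absurd (leOfHom g) hx
      have hφ : φ.app m ≫ adj.counit.app (F.obj m) = 𝟙 _ := adj.left_triangle_components F
      have hc : Mono (adj.counit.app (F.obj m)) := by
        refine ⟨fun {W} s t hst => Pi.hom_ext (f := fun _ : m ⟶ m => F.obj m) s t fun g => ?_⟩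
        have e : adj.counit.app (F.obj m) = Pi.π (fun _ : m ⟶ m => F.obj m) (𝟙 m) :=
          evaluationAdjunctionLeft_counit_app _ _ _
        rw [Subsingleton.elim g (𝟙 m), ← e]
        exact hst
      -- `φ` is an isomorphism at `m`, since the counit there is the projection from a product
      -- over a singleton
      have hmono : Mono (φ.app m) := mono_of_mono_fac hφ
      have hepi : Epi (φ.app m) := by
        have : IsIso (adj.counit.app (F.obj m)) := by
          have : IsSplitEpi (adj.counit.app (F.obj m)) := ⟨⟨⟨_, hφ⟩⟩⟩
          exact isIso_of_mono_of_isSplitEpi _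
        rw [← IsIso.eq_comp_inv, Category.id_comp] at hφ
        rw [hφ]
        infer_instance
      have hK : HasInjectiveDimensionLT (kernel φ) S.card := by
        rw [← hcard]
        refine ih _ (Finset.erase_ssubset hm.1) hS' _ fun x hx => ?_
        have : Mono ((kernel.ι φ).app x) := inferInstance
        by_cases hxm : x = m
        · subst hxm
          have h0 : (kernel.ι φ).app x = 0 := by
            rw [← cancel_mono (φ.app x), zero_comp]
            exact NatTrans.congr_app (kernel.condition φ) x
          exact IsZero.of_mono_eq_zero _ h0
        · exact IsZero.of_mono ((kernel.ι φ).app x)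
            (hF x fun h => hx (Finset.mem_erase.2 ⟨hxm, h⟩))
      have hQ : HasInjectiveDimensionLT (cokernel φ) S.card := by
        rw [← hcard]
        refine ih _ (Finset.erase_ssubset hm.1) hS' _ fun x hx => ?_
        have : Epi ((cokernel.π φ).app x) := inferInstance
        by_cases hxm : x = m
        · subst hxm
          have h0 : (cokernel.π φ).app x = 0 := by
            rw [← cancel_epi (φ.app x), comp_zero]
            exact NatTrans.congr_app (cokernel.condition φ) x
          exact IsZero.of_epi_eq_zero _ h0
        · exact IsZero.of_epi ((cokernel.π φ).app x)
            (hRx x fun h => hx (Finset.mem_erase.2 ⟨hxm, hS h hm.1⟩))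
      have h₁ : (ShortComplex.mk _ _ (cokernel.condition (kernel.ι φ))).ShortExact :=
        { exact := ShortComplex.exact_cokernel _ }
      have h₂ : (ShortComplex.mk _ _ (kernel.condition (cokernel.π φ))).ShortExact :=
        { exact := ShortComplex.exact_kernel _ }
      have hI : HasInjectiveDimensionLT (Abelian.image φ) (S.card + 1) :=
        h₂.hasInjectiveDimensionLT_X₁ _ hQ (hasInjectiveDimensionLT_of_ge R 1 _ (by lia))
      have hI' := hasInjectiveDimensionLT_of_iso (Abelian.coimageIsoImage φ).symm (S.card + 1)
      exact h₁.hasInjectiveDimensionLT_X₂ _ (hasInjectiveDimensionLT_of_ge _ S.card _ (by lia)) hI'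

variable (k X) in
theorem exists_hasInjectiveDimensionLT [Finite X] :
    ∃ N : ℕ, ∀ F : PosetSheaf k X, HasInjectiveDimensionLT F (N + 1) := by
  have := Fintype.ofFinite X
  exact ⟨_, fun F => hasInjectiveDimensionLT_of_support Finset.univ
    (by simpa using isLowerSet_univ) F fun x hx => absurd (Finset.mem_univ x) hx⟩

end InjectiveDimension

/-! ### Hypercohomology and the filtration by open sets -/

section Hypercohomology

open Pretriangulated

variable {k : Type u} [Field k] {X : Type v} [PartialOrder X]

theorem cohomologyDim_Q (j : ℤ) (K : CochainComplex (FGModuleCat.{u} k) ℤ) :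
    cohomologyDim j (DerivedCategory.Q.obj K) = Module.finrank k (K.homology j) :=
  finrank_eq_of_iso ((DerivedCategory.homologyFunctorFactors _ j).app K)

theorem finite_setOf_not_isZero_homology (K : CochainComplex.Plus (FGModuleCat.{u} k)) (b : ℤ)
    (hb : K.obj.IsStrictlyLE b) : {j : ℤ | ¬ IsZero (K.obj.homology j)}.Finite := by
  obtain ⟨a, ha⟩ := K.property
  refine (Set.finite_Icc a b).subset fun j hj => ?_
  by_contra h
  rw [Set.mem_Icc, not_and_or, not_le, not_le] at h
  refine hj (ShortComplex.isZero_homology_of_isZero_X₂ _ ?_)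
  rcases h with h | h
  · exact K.obj.isZero_of_isStrictlyGE a j h
  · exact K.obj.isZero_of_isStrictlyLE b j h

section

variable [Finite X]

theorem hdim_eq_of_iso (j : ℤ) {I J : DPlus k X} (e : I ≅ J) : hdim j I = hdim j J :=
  finrank_eq_of_iso ((DerivedCategory.Plus.homologyFunctor _ j).mapIso
    ((globalSections k X).rightDerivedFunctorPlus.mapIso e))

/-- Hypercohomology is computed by global sections of a complex of injectives. -/
def hypercohomologyIso (J : CochainComplex.Plus (PosetSheaf k X))
    (hJ : ∀ i, Injective (J.obj.X i)) (j : ℤ) :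
    hypercohomology j (DerivedCategory.Plus.Q.obj J) ≅
      (((globalSections k X).mapHomologicalComplex _).obj J.obj).homology j :=
  (DerivedCategory.Plus.homologyFunctor _ j).mapIso (rightDerivedQIso _ J hJ) ≪≫
    homologyQIso _ j

theorem finite_support_hdim {I : DPlus k X} (h : FiniteHypercohomology I) :
    (Function.support fun j => hdim j I).Finite :=
  h.subset fun _ hj h0 => hj (finrank_eq_zero_of_isZero h0)

theorem finiteHypercohomology_of_isLE (I : DPlus k X) (b : ℤ) (hb : I.obj.IsLE b) :
    FiniteHypercohomology I := by
  obtain ⟨N, hN⟩ := exists_hasInjectiveDimensionLT k X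
  obtain ⟨J, hJ, ⟨m, hm⟩, ⟨e⟩⟩ := exists_bounded_injective N hN I b hb
  refine (finite_setOf_not_isZero_homology ((globalSections k X).mapCochainComplexPlus.obj J) m
    (inferInstanceAs (CochainComplex.IsStrictlyLE
      (((globalSections k X).mapHomologicalComplex _).obj J.obj) m))).subset fun j hj h0 => hj ?_
  exact h0.of_iso ((DerivedCategory.Plus.homologyFunctor _ j).mapIso
    ((globalSections k X).rightDerivedFunctorPlus.mapIso e) ≪≫ hypercohomologyIso J hJ j)

/-- Hypercohomology dimensions in a short exact sequence of complexes of sheaves. -/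
theorem morseRel_hdim {A B C : CochainComplex.Plus (PosetSheaf k X)} (f : A ⟶ B) (g : B ⟶ C)
    (w : f.hom ≫ g.hom = 0) (h : (ShortComplex.mk f.hom g.hom w).ShortExact) :
    MorseRel (fun j => hdim j (DerivedCategory.Plus.Q.obj B))
      (fun j => hdim j (DerivedCategory.Plus.Q.obj A) +
        hdim j (DerivedCategory.Plus.Q.obj C)) := by
  -- the cone of `f` in `D^+` is `C`, as one sees in the unbounded derived category
  obtain ⟨Z, g', h', hT⟩ := distinguished_cocone_triangle (DerivedCategory.Plus.Q.map f)
  have hT' := DerivedCategory.Plus.ι.map_distinguished _ hT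
  let e := isoTriangleOfIso₁₂ _ _ hT' (DerivedCategory.triangleOfSES_distinguished h)
    (Iso.refl _) (Iso.refl _) (by
      change DerivedCategory.Q.map f.hom ≫ 𝟙 _ = 𝟙 _ ≫ DerivedCategory.Q.map f.hom
      simp)
  let e₃ : Z ≅ DerivedCategory.Plus.Q.obj C :=
    DerivedCategory.Plus.ι.preimageIso (Triangle.π₃.mapIso e)
  obtain ⟨T, hTd, ⟨e₁⟩, ⟨e₂⟩, ⟨e₃'⟩⟩ :=
    exists_distTriang_rightDerived (globalSections k X) _ hT
  have H := morseRel_of_distTriang _ (DerivedCategory.Plus.ι.map_distinguished _ hTd)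
  have h₁ (j : ℤ) : cohomologyDim j T.obj₁.obj = hdim j (DerivedCategory.Plus.Q.obj A) :=
    cohomologyDim_eq_of_iso j (DerivedCategory.Plus.ι.mapIso e₁)
  have h₂ (j : ℤ) : cohomologyDim j T.obj₂.obj = hdim j (DerivedCategory.Plus.Q.obj B) :=
    cohomologyDim_eq_of_iso j (DerivedCategory.Plus.ι.mapIso e₂)
  have h₃ (j : ℤ) : cohomologyDim j T.obj₃.obj = hdim j (DerivedCategory.Plus.Q.obj C) :=
    (cohomologyDim_eq_of_iso j (DerivedCategory.Plus.ι.mapIso e₃')).trans (hdim_eq_of_iso j e₃)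
  exact H.congr h₂ fun j => congrArg₂ (· + ·) (h₁ j) (h₃ j)

end

variable {Y : Type w} [PartialOrder Y] (f : X →o Y)

theorem locallyClosed_of_isUpperSet {U : Set X} (hU : IsUpperSet U) : LocallyClosed U :=
  ⟨U, Set.univ, hU, @isClosed_univ _ (Topology.upperSet X), by simp⟩

/-- The complex `J_Z` with terms the extensions by zero of the restrictions to `Z`. -/
abbrev extendRestrictComplex {Z : Set X} (hZ : LocallyClosed Z)
    (J : CochainComplex.Plus (PosetSheaf k X)) : CochainComplex.Plus (PosetSheaf k X) :=
  (extendRestrict k hZ).mapCochainComplexPlus.obj J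

/-- `R i_{Z!} R i_Z^*` is extension by zero of the restriction to `Z`, applied term by term. -/
theorem nonempty_RProperPushforward_RPullback_iso [Finite X] {Z : Set X} (hZ : LocallyClosed Z)
    (J : CochainComplex.Plus (PosetSheaf k X)) :
    Nonempty ((RProperPushforward hZ).obj ((RPullback Z).obj (DerivedCategory.Plus.Q.obj J)) ≅
      DerivedCategory.Plus.Q.obj (extendRestrictComplex hZ J)) := by
  obtain ⟨e⟩ := nonempty_rightDerivedQIso_of_exact (sheafPullback k Z) J
  obtain ⟨e'⟩ := nonempty_rightDerivedQIso_of_exact (properPushforward k hZ)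
    ((sheafPullback k Z).mapCochainComplexPlus.obj J)
  exact ⟨(RProperPushforward hZ).mapIso e ≪≫ e'⟩

/-- The hypercohomology of `R i_Z^! J` is the cohomology of the complex `Γ(Z, i_Z^! J)`. -/
theorem nonempty_hypercohomology_RProperPullback_iso [Finite X] {Z : Set X}
    (hZ : LocallyClosed Z) (J : CochainComplex.Plus (PosetSheaf k X))
    (hJ : ∀ i, Injective (J.obj.X i)) (j : ℤ) :
    Nonempty (hypercohomology j ((RProperPullback hZ).obj (DerivedCategory.Plus.Q.obj J)) ≅
      (((sectionsWithSupport Z).mapHomologicalComplex _).obj J.obj).homology j) := by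
  have e : (RProperPullback hZ).obj (DerivedCategory.Plus.Q.obj J) ≅
      DerivedCategory.Plus.Q.obj ((properPullback k Z).mapCochainComplexPlus.obj J) :=
    rightDerivedQIso (properPullback k Z) J hJ
  exact ⟨(DerivedCategory.Plus.homologyFunctor _ j).mapIso
    ((globalSections k Z).rightDerivedFunctorPlus.mapIso e) ≪≫
    hypercohomologyIso _ (fun i => have := hJ i; injective_properPullback hZ (J.obj.X i)) j⟩

variable {f} in
theorem preimage_insert_eq_union {U V : Set Y} {p : Y} (h : V = insert p U) :
    f ⁻¹' V = f ⁻¹' U ∪ f ⁻¹' {p} := by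
  rw [h, Set.insert_eq, Set.union_comm]
  rfl

variable {f} in
theorem disjoint_preimage {U : Set Y} {p : Y} (hp : p ∉ U) : Disjoint (f ⁻¹' U) (f ⁻¹' {p}) :=
  Disjoint.preimage f (Set.disjoint_singleton_right.2 hp)

/-- The relation between the hypercohomology of a complex and that of its extensions by zero from
the fibers of `f`. -/
theorem morseRel_extendRestrict [Finite X] [Fintype Y] (J : CochainComplex.Plus (PosetSheaf k X)) :
    MorseRel (fun j => hdim j (DerivedCategory.Plus.Q.obj J))
      (fun j => ∑ p : Y, hdim j (DerivedCategory.Plus.Q.obj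
        (extendRestrictComplex (locallyClosed_fiber f p) J))) := by
  have hlc (U : Set Y) (hU : IsUpperSet U) : LocallyClosed (f ⁻¹' U) :=
    locallyClosed_of_isUpperSet (hU.preimage f.monotone)
  have key := morseRel_sum
    (fun U hU j => hdim j (DerivedCategory.Plus.Q.obj (extendRestrictComplex (hlc U hU) J)))
    (fun p j => hdim j (DerivedCategory.Plus.Q.obj
        (extendRestrictComplex (locallyClosed_fiber f p) J))) ?_ ?_
  · let e : extendRestrictComplex (hlc _ isUpperSet_univ) J ≅ J :=
      CochainComplex.Plus.ι _ |>.preimageIso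
        ((NatIso.mapHomologicalComplex (extendRestrictUniv (hlc _ isUpperSet_univ)
          Set.preimage_univ) (.up ℤ)).app J.obj ≪≫
          (Functor.mapHomologicalComplexIdIso _ _).app J.obj)
    have he (j : ℤ) := hdim_eq_of_iso j (DerivedCategory.Plus.Q.mapIso e)
    simpa only [he] using key
  · intro hU j
    have h0 (i : ℤ) : IsZero ((extendRestrictComplex (hlc ∅ hU) J).obj.X i) :=
      isZero_extendRestrict (hlc ∅ hU) Set.preimage_empty (J.obj.X i)
    refine finrank_eq_zero_of_isZero (IsZero.of_iso ?_ (hypercohomologyIso _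
      (fun i => Injective.of_iso (h0 i).isoZero.symm inferInstance) j))
    exact ShortComplex.isZero_homology_of_isZero_X₂ _ ((globalSections k X).map_isZero (h0 j))
  · intro U V hU hV p hp hUV
    obtain ⟨h₁, h₂, w, H⟩ := shortExact_compare (k := k) (hlc U hU) (hlc V hV)
      (locallyClosed_fiber f p) (hU.preimage f.monotone) (preimage_insert_eq_union hUV)
      (disjoint_preimage hp)
    refine morseRel_hdim
      (ObjectProperty.homMk ((NatTrans.mapHomologicalComplex (compare _ _ h₁) (.up ℤ)).app J.obj))
      (ObjectProperty.homMk ((NatTrans.mapHomologicalComplex (compare _ _ h₂) (.up ℤ)).app J.obj))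
      (by ext i : 1; exact NatTrans.congr_app w (J.obj.X i)) ?_
    exact HomologicalComplex.shortExact_of_degreewise_shortExact _ fun i => H (J.obj.X i)

/-- The relation between the hypercohomology of a complex of injectives and its cohomology with
support in the fibers of `f`. -/
theorem morseRel_sections [Finite X] [Fintype Y] (J : CochainComplex.Plus (PosetSheaf k X))
    (hJ : ∀ i, Injective (J.obj.X i)) :
    MorseRel (fun j => hdim j (DerivedCategory.Plus.Q.obj J))
      (fun j => ∑ p : Y, hdim j ((RProperPullback (locallyClosed_fiber f p)).obj
        (DerivedCategory.Plus.Q.obj J))) := by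
  have hlc (U : Set Y) (hU : IsUpperSet U) : LocallyClosed (f ⁻¹' U) :=
    locallyClosed_of_isUpperSet (hU.preimage f.monotone)
  let Γ (Z : Set X) : CochainComplex (FGModuleCat.{u} k) ℤ :=
    ((sectionsWithSupport Z).mapHomologicalComplex _).obj J.obj
  have hc (p : Y) (j : ℤ) : hdim j ((RProperPullback (locallyClosed_fiber f p)).obj
      (DerivedCategory.Plus.Q.obj J)) = cohomologyDim j (DerivedCategory.Q.obj (Γ (f ⁻¹' {p}))) := by
    obtain ⟨e⟩ := nonempty_hypercohomology_RProperPullback_iso (locallyClosed_fiber f p) J hJ j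
    exact (finrank_eq_of_iso e).trans (cohomologyDim_Q j _).symm
  have hJ' (j : ℤ) : hdim j (DerivedCategory.Plus.Q.obj J) =
      cohomologyDim j (DerivedCategory.Q.obj (Γ (f ⁻¹' Set.univ))) := by
    let e : ((globalSections k X).mapHomologicalComplex _).obj J.obj ≅ Γ (f ⁻¹' Set.univ) :=
      (NatIso.mapHomologicalComplex (sectionsUniv (hlc _ isUpperSet_univ)
        Set.preimage_univ) (.up ℤ)).app J.obj
    rw [cohomologyDim_Q]
    exact finrank_eq_of_iso (hypercohomologyIso J hJ j ≪≫
      (HomologicalComplex.homologyFunctor _ _ j).mapIso e)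
  simp only [hc, hJ']
  refine morseRel_sum (fun U _ j => cohomologyDim j (DerivedCategory.Q.obj (Γ (f ⁻¹' U))))
    (fun p j => cohomologyDim j (DerivedCategory.Q.obj (Γ (f ⁻¹' {p})))) ?_ ?_
  · intro hU j
    refine (cohomologyDim_Q j _).trans (finrank_eq_zero_of_isZero
      (ShortComplex.isZero_homology_of_isZero_X₂ _ ?_))
    exact isZero_sections (hlc ∅ hU) Set.preimage_empty (J.obj.X j)
  · intro U V hU hV p hp hUV
    obtain ⟨α, β, H⟩ := shortExact_sections (k := k) (hlc U hU) (hlc V hV)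
      (locallyClosed_fiber f p) (hU.preimage f.monotone) (preimage_insert_eq_union hUV)
      (disjoint_preimage hp)
    have w : (NatTrans.mapHomologicalComplex α (.up ℤ)).app J.obj ≫
        (NatTrans.mapHomologicalComplex β (.up ℤ)).app J.obj = 0 := by
      ext i : 1
      exact (H (J.obj.X i)).choose
    have hS : (ShortComplex.mk _ _ w).ShortExact :=
      HomologicalComplex.shortExact_of_degreewise_shortExact _ fun i =>
        (H (J.obj.X i)).choose_spec
    exact (morseRel_of_distTriang _ (DerivedCategory.triangleOfSES_distinguished hS)).congr
      (fun _ => rfl) (fun _ => add_comm _ _)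

end Hypercohomology

end MorsePoset

end

theorem mainTheorem5 {k : Type u} [Field k] {Λ : Type v} [PartialOrder Λ] [Finite Λ]
    {P : Type w} [PartialOrder P] [Finite P] (f : Λ →o P) (I : MorsePoset.Db k Λ) :
    (MorsePoset.FiniteHypercohomology I.toPlus ∧
      (∀ π : P, MorsePoset.FiniteHypercohomology (MorsePoset.shriekFiber I f π)) ∧
      (∀ π : P, MorsePoset.FiniteHypercohomology (MorsePoset.starFiber I f π))) ∧
    (∀ ℓ : ℤ, (ℓ.negOnePow : ℤ) * MorsePoset.truncatedEuler ℓ I.toPlus ≤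
      (ℓ.negOnePow : ℤ) * ∑ᶠ π ∈ MorsePoset.shriekCritical I f,
        MorsePoset.truncatedEuler ℓ (MorsePoset.shriekFiber I f π)) ∧
    (∀ ℓ : ℤ, (ℓ.negOnePow : ℤ) * MorsePoset.truncatedEuler ℓ I.toPlus ≤
      (ℓ.negOnePow : ℤ) * ∑ᶠ π ∈ MorsePoset.starCritical I f,
        MorsePoset.truncatedEuler ℓ (MorsePoset.starFiber I f π)) ∧
    MorsePoset.eulerChar I.toPlus =
      ∑ᶠ π ∈ MorsePoset.shriekCritical I f,
        MorsePoset.eulerChar (MorsePoset.shriekFiber I f π) ∧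
    MorsePoset.eulerChar I.toPlus =
      ∑ᶠ π ∈ MorsePoset.starCritical I f,
        MorsePoset.eulerChar (MorsePoset.starFiber I f π) := by
  open MorsePoset in
  have := Fintype.ofFinite P
  obtain ⟨b, hb⟩ := I.property.2
  have hb' : DerivedCategory.IsLE I.toPlus.obj b := hb
  obtain ⟨N, hN⟩ := exists_hasInjectiveDimensionLT k Λ
  obtain ⟨J, hJ, ⟨m, hm⟩, ⟨e⟩⟩ := exists_bounded_injective N hN I.toPlus b hb'
  have hshriek (π : P) : FiniteHypercohomology (shriekFiber I f π) := by
    refine (finite_setOf_not_isZero_homology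
      ((sectionsWithSupport (f ⁻¹' {π})).mapCochainComplexPlus.obj J) m
      (inferInstanceAs (CochainComplex.IsStrictlyLE
        (((sectionsWithSupport (f ⁻¹' {π})).mapHomologicalComplex _).obj J.obj) m))).subset
      fun j hj h0 => hj ?_
    obtain ⟨e'⟩ :=
      nonempty_hypercohomology_RProperPullback_iso (locallyClosed_fiber f π) J hJ j
    exact h0.of_iso ((DerivedCategory.Plus.homologyFunctor _ j).mapIso
      ((globalSections k _).rightDerivedFunctorPlus.mapIso
        ((RProperPullback (locallyClosed_fiber f π)).mapIso e)) ≪≫ e')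
  have estar (π : P) : Nonempty (starFiber I f π ≅ DerivedCategory.Plus.Q.obj
      (extendRestrictComplex (locallyClosed_fiber f π) J)) := by
    obtain ⟨e'⟩ := nonempty_RProperPushforward_RPullback_iso (locallyClosed_fiber f π) J
    exact ⟨(RProperPushforward (locallyClosed_fiber f π)).mapIso ((RPullback _).mapIso e) ≪≫ e'⟩
  have hstar (π : P) : FiniteHypercohomology (starFiber I f π) := by
    obtain ⟨e'⟩ := estar π
    refine finiteHypercohomology_of_isLE _ m ?_
    have h₁ : (extendRestrictComplex (locallyClosed_fiber f π) J).obj.IsStrictlyLE m :=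
      inferInstanceAs (CochainComplex.IsStrictlyLE
        (((extendRestrict k (locallyClosed_fiber f π)).mapHomologicalComplex _).obj J.obj) m)
    have h₂ : DerivedCategory.TStructure.t.IsLE (DerivedCategory.Plus.ι.obj
        (DerivedCategory.Plus.Q.obj (extendRestrictComplex (locallyClosed_fiber f π) J))) m :=
      inferInstanceAs ((DerivedCategory.Q.obj
        (extendRestrictComplex (locallyClosed_fiber f π) J).obj).IsLE m)
    exact DerivedCategory.TStructure.t.isLE_of_iso (DerivedCategory.Plus.ι.mapIso e'.symm) m
  have h₁ : MorseRel (fun j => hdim j I.toPlus) (fun j => ∑ π, hdim j (shriekFiber I f π)) :=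
    (morseRel_sections f J hJ).congr (fun j => (hdim_eq_of_iso j e).symm)
      fun j => Finset.sum_congr rfl fun π _ =>
        (hdim_eq_of_iso j ((RProperPullback (locallyClosed_fiber f π)).mapIso e)).symm
  have h₂ : MorseRel (fun j => hdim j I.toPlus) (fun j => ∑ π, hdim j (starFiber I f π)) :=
    (morseRel_extendRestrict f J).congr (fun j => (hdim_eq_of_iso j e).symm)
      fun j => Finset.sum_congr rfl fun π _ => (hdim_eq_of_iso j (estar π).some).symm
  have hK₁ : ∀ π ∉ shriekCritical I f, ∀ j, hdim j (shriekFiber I f π) = 0 := by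
    intro π hπ j
    by_contra h
    exact hπ ⟨locallyClosed_fiber f π, j, fun h0 => h (finrank_eq_zero_of_isZero h0)⟩
  have hK₂ : ∀ π ∉ starCritical I f, ∀ j, hdim j (starFiber I f π) = 0 := by
    intro π hπ j
    by_contra h
    exact hπ ⟨locallyClosed_fiber f π, j, fun h0 => h (finrank_eq_zero_of_isZero h0)⟩
  obtain ⟨H₁, H₁'⟩ := h₁.inequalities (fun π => finite_support_hdim (hshriek π)) _ hK₁
  obtain ⟨H₂, H₂'⟩ := h₂.inequalities (fun π => finite_support_hdim (hstar π)) _ hK₂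
  exact ⟨⟨finiteHypercohomology_of_isLE _ b hb', hshriek, hstar⟩, H₁, H₂, H₁', H₂'⟩
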